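/- There is an absolute constant $c>0$ such that the following holds for all $\epsilon\in(0,1)$ and all integers $n\ge 1/\epsilon^2$. Consider a (possibly randomized) algorithm with access to an unknown real symmetric matrix $A\in\mathbb{R}^{n\times n}$ only through $k$ matrix-vector queries: it receives the products $Av^1,\ldots,Av^k$, where each query vector $v^{i}\in\mathbb{R}^n$ may be chosen adaptively, as a (measurable) function of the algorithm's randomness and of the previous products $Av^1,\ldots,Av^{i-1}$, and then it outputs real numbers $\mu_1,\ldots,\mu_n$ that depend (measurably) on its randomness and on the $k$ products. Suppose that for every real symmetric $A\in\mathbb{R}^{n\times n}$ with eigenvalues $\lambda_1\ge\cdots\ge\lambda_n$ (counted with multiplicity), with probability at least $3/4$ over the algorithm's randomness, \[ |\mu_i-\lambda_i|\le \epsilon\|A\|_F\quad\text{simultaneously for all } i=1,\ldots,n . \] Then $k\ge c/\epsilon^2$. -/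

import Mathlib

open MeasureTheory

/-- A (possibly randomized, possibly adaptive) algorithm making `k` matrix-vector queries to an
unknown real `n × n` matrix `A`. The internal randomness is a point `ω` of a sample space `Ω`.
The `i`-th query vector is a function of `ω` and of the answers to the earlier queries; after
`k` answers the algorithm outputs `n` real numbers. (Earlier query vectors are themselves
functions of `ω` and of earlier answers, so they need not be passed on; only the components
`query i` with `i < k` are ever used.) -/
structure MatVecAlgorithm (Ω : Type*) [MeasurableSpace Ω] (n k : ℕ) where
  query : (i : ℕ) → Ω → (Fin i → Fin n → ℝ) → (Fin n → ℝ)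
  output : Ω → (Fin k → Fin n → ℝ) → (Fin n → ℝ)
  measurable_query : ∀ i, Measurable (fun p : Ω × (Fin i → Fin n → ℝ) => query i p.1 p.2)
  measurable_output : Measurable (fun p : Ω × (Fin k → Fin n → ℝ) => output p.1 p.2)

namespace MatVecAlgorithm

variable {Ω : Type*} [MeasurableSpace Ω] {n k : ℕ}

/-- The answers `A v₀, …, A vᵢ₋₁` to the first `i` queries, on input `A` with randomness `ω`. -/
def answers (alg : MatVecAlgorithm Ω n k) (A : Matrix (Fin n) (Fin n) ℝ) (ω : Ω) :
    (i : ℕ) → (Fin i → Fin n → ℝ)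
  | 0 => Fin.elim0
  | i + 1 => Fin.snoc (α := fun _ => Fin n → ℝ) (alg.answers A ω i)
      (A.mulVec (alg.query i ω (alg.answers A ω i)))

/-- The output of the algorithm on input `A` with randomness `ω`, after `k` queries. -/
def run (alg : MatVecAlgorithm Ω n k) (A : Matrix (Fin n) (Fin n) ℝ) (ω : Ω) : Fin n → ℝ :=
  alg.output ω (alg.answers A ω k)

end MatVecAlgorithm

section
open scoped Matrix.Norms.Frobenius

/-- The Frobenius norm `‖A‖_F`. -/
noncomputable def frobeniusNorm {n : ℕ} (A : Matrix (Fin n) (Fin n) ℝ) : ℝ := ‖A‖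

end

/-- The eigenvalues `λ₁ ≥ … ≥ λₙ` of a real symmetric matrix, with multiplicity, in
non-increasing order. -/
noncomputable def sortedEigenvalues {n : ℕ} {A : Matrix (Fin n) (Fin n) ℝ}
    (hA : A.IsHermitian) : Fin n → ℝ :=
  fun i => hA.eigenvalues₀ (Fin.cast (Fintype.card_fin n).symm i)

/-- For every real symmetric `A`, with probability at least `3/4` over the algorithm's randomness,
the output `(μ₁, …, μₙ)` satisfies `|μᵢ - λᵢ(A)| ≤ ε ‖A‖_F` simultaneously for all `i`. -/
def EstimatesEigenvalues {Ω : Type*} [MeasurableSpace Ω] (P : Measure Ω) {n k : ℕ}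
    (alg : MatVecAlgorithm Ω n k) (ε : ℝ) : Prop :=
  ∀ (A : Matrix (Fin n) (Fin n) ℝ) (hA : A.IsHermitian),
    3 / 4 ≤ P.real {ω | ∀ i, |alg.run A ω i - sortedEigenvalues hA i| ≤ ε * frobeniusNorm A}

/-! The hard inputs are Wishart matrices GGᵀ, where G is an n × q matrix of independent standard
Gaussians and q is either 8k or 8k + 2. If k is below a small multiple of 1/ε², then q is far below
n, and all singular values of G lie between √n/32 and 8√n except with exponentially small
probability. The eigenvalue of index 8k, counted from 0, is then 0 for the smaller q and at least
n/1024 for the larger, while ε‖GGᵀ‖_F ≤ 64nε√q ≤ n/4096. Thresholding a single output would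
therefore tell the two ranks apart.

Adaptive products cannot do this with only k queries. By rotation invariance the first query may be
taken along e₀. Rotating the columns of G so that its first row g becomes |g|e₀ turns GGᵀ into a
matrix with first row (|g|², |g|h) and lower block hhᵀ + G'G'ᵀ, where g, h, G' are independent
Gaussians and G' has one row and one column fewer (`lintegral_gram_succ`). The answer depends only
on |g| and h, and what remains is a smaller Wishart matrix, so the argument recurses.

Each query thus costs one comparison of the lengths of Gaussian vectors in dimensions r + 2 and r.
The density ratio is t²/r, with second moment (r + 2)/r; a jump of two in the rank keeps this weight
polynomial. Over r = s + 1, …, s + k these factors telescope, and Cauchy–Schwarz gives (E_{s+k+2}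
f)² ≤ (s+k+2)(s+k+1)/((s+2)(s+1)) · E_{s+k} f² (`sq_lintegral_gram_le`). For s = 7k the factor is at
most 64/49, which is incompatible with a threshold test that succeeds with probability close to 3/4
on both ranks. -/

/-- The standard Gaussian measure on `ι → ℝ`. -/
noncomputable def gauss (ι : Type*) [Fintype ι] : Measure (ι → ℝ) :=
  Measure.pi fun _ => ProbabilityTheory.gaussianReal 0 1

instance (ι : Type*) [Fintype ι] : IsProbabilityMeasure (gauss ι) := by
  unfold gauss; infer_instance

/-! ### Gaussian vectors and rotation invariance -/

section Gauss

variable {ι κ : Type*} [Fintype ι] [Fintype κ]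

theorem measurePreserving_toLp_gauss :
    MeasurePreserving (WithLp.toLp 2 : (ι → ℝ) → EuclideanSpace ℝ ι) (gauss ι)
      (ProbabilityTheory.stdGaussian (EuclideanSpace ℝ ι)) :=
  ⟨by fun_prop, ProbabilityTheory.map_pi_eq_stdGaussian⟩

/-- The standard Gaussian measure is invariant under linear isometries. -/
theorem measurePreserving_gauss_of_isometry (hc : Fintype.card ι = Fintype.card κ)
    (f : (ι → ℝ) →ₗ[ℝ] (κ → ℝ)) (hf : ∀ x, ∑ i, f x i ^ 2 = ∑ i, x i ^ 2) :
    MeasurePreserving f (gauss ι) (gauss κ) := by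
  let e : EuclideanSpace ℝ ι →ₗᵢ[ℝ] EuclideanSpace ℝ κ :=
    { toLinearMap := (WithLp.linearEquiv 2 ℝ (κ → ℝ)).symm.toLinearMap ∘ₗ f ∘ₗ
        (WithLp.linearEquiv 2 ℝ (ι → ℝ)).toLinearMap
      norm_map' := fun x => by
        simp [EuclideanSpace.norm_eq, hf] }
  let e' : EuclideanSpace ℝ ι ≃ₗᵢ[ℝ] EuclideanSpace ℝ κ :=
    e.toLinearIsometryEquiv (by simp [hc])
  have h1 : MeasurePreserving e' (ProbabilityTheory.stdGaussian (EuclideanSpace ℝ ι))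
      (ProbabilityTheory.stdGaussian (EuclideanSpace ℝ κ)) :=
    ⟨by fun_prop, ProbabilityTheory.stdGaussian_map e'⟩
  have h2 : MeasurePreserving (WithLp.ofLp : EuclideanSpace ℝ κ → (κ → ℝ))
      (ProbabilityTheory.stdGaussian (EuclideanSpace ℝ κ)) (gauss κ) := by
    have := (measurePreserving_toLp_gauss (ι := κ))
    exact MeasurePreserving.symm (MeasurableEquiv.toLp 2 (κ → ℝ)) this
  exact (h2.comp h1).comp measurePreserving_toLp_gauss

theorem measurePreserving_gauss_reindex (e : ι ≃ κ) :
    MeasurePreserving (fun x : κ → ℝ => x ∘ e) (gauss κ) (gauss ι) :=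
  measurePreserving_gauss_of_isometry (Fintype.card_congr e.symm)
    (LinearMap.funLeft ℝ ℝ e) fun x => by
      simpa [LinearMap.funLeft_apply] using e.sum_comp fun j => x j ^ 2

/-- Two independent standard Gaussian vectors form a standard Gaussian vector. -/
theorem measurePreserving_gauss_sumElim :
    MeasurePreserving (fun p : (ι → ℝ) × (κ → ℝ) => (Sum.elim p.1 p.2 : ι ⊕ κ → ℝ))
      ((gauss ι).prod (gauss κ)) (gauss (ι ⊕ κ)) := by
  have := measurePreserving_sumPiEquivProdPi_symm (X := fun _ : ι ⊕ κ => ℝ)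
    (fun _ => ProbabilityTheory.gaussianReal 0 1)
  convert this using 1
  · ext p i
    cases i <;> rfl
  · rfl
  · rfl

theorem measurePreserving_gauss_split {α : Type*} [Fintype α] (e : α ≃ ι ⊕ κ) :
    MeasurePreserving (fun p : (ι → ℝ) × (κ → ℝ) => (Sum.elim p.1 p.2 ∘ e : α → ℝ))
      ((gauss ι).prod (gauss κ)) (gauss α) :=
  (measurePreserving_gauss_reindex e).comp measurePreserving_gauss_sumElim

/-- A marginal of a standard Gaussian vector is a standard Gaussian vector. -/
theorem lintegral_gauss_split {α : Type*} [Fintype α] (e : α ≃ ι ⊕ κ) {f : (α → ℝ) → ENNReal}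
    (hf : Measurable f) :
    ∫⁻ x, f x ∂gauss α = ∫⁻ y, ∫⁻ z, f (Sum.elim y z ∘ e) ∂gauss κ ∂gauss ι := by
  rw [← (measurePreserving_gauss_split e).lintegral_comp hf, lintegral_prod]
  exact (hf.comp (measurePreserving_gauss_split e).measurable).aemeasurable

/-- Euclidean length of a vector. -/
noncomputable def len (x : ι → ℝ) : ℝ := Real.sqrt (∑ i, x i ^ 2)

theorem len_sq (x : ι → ℝ) : len x ^ 2 = ∑ i, x i ^ 2 :=
  Real.sq_sqrt (Finset.sum_nonneg fun _ _ => sq_nonneg _)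

@[fun_prop]
theorem measurable_len : Measurable (len : (ι → ℝ) → ℝ) := by
  unfold len; fun_prop

theorem len_eq_norm (x : ι → ℝ) : len x = ‖WithLp.toLp 2 x‖ := by
  simp [len, EuclideanSpace.norm_eq]

end Gauss

/-- For every vector `v` of dimension `r + 1` some orthogonal matrix maps `|v| e₀` to `v`. -/
theorem exists_orthogonal_mulVec {r : ℕ} (v : Fin (r + 1) → ℝ) :
    ∃ R : Matrix (Fin (r + 1)) (Fin (r + 1)) ℝ, R.transpose * R = 1 ∧ R * R.transpose = 1 ∧
      ∀ i, v i = len v * R i 0 := by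
  obtain ⟨u, hu, huv⟩ : ∃ u : EuclideanSpace ℝ (Fin (r + 1)), ‖u‖ = 1 ∧
      WithLp.toLp 2 v = len v • u := by
    by_cases h : WithLp.toLp 2 v = 0
    -- For v = 0 the direction is immaterial, so any unit vector will do.
    · refine ⟨EuclideanSpace.single 0 1, by simp, ?_⟩
      rw [len_eq_norm, h]; simp
    · refine ⟨(‖WithLp.toLp 2 v‖)⁻¹ • WithLp.toLp 2 v, ?_, ?_⟩
      · rw [norm_smul, norm_inv, norm_norm, inv_mul_cancel₀ (norm_ne_zero_iff.2 h)]
      · rw [len_eq_norm, smul_smul, mul_inv_cancel₀ (norm_ne_zero_iff.2 h), one_smul]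
  have ho : Orthonormal ℝ (({0} : Set (Fin (r + 1))).domRestrict fun _ => u) := by
    refine ⟨fun i => hu, fun i j hij => ?_⟩
    exact absurd (Subtype.ext ((Set.mem_singleton_iff.1 i.2).trans
      (Set.mem_singleton_iff.1 j.2).symm)) hij
  obtain ⟨b, hb⟩ := ho.exists_orthonormalBasis_extension_of_card_eq (by simp)
  have hb0 : b 0 = u := hb 0 rfl
  let R : Matrix (Fin (r + 1)) (Fin (r + 1)) ℝ := Matrix.of fun i j => b j i
  have hR : R.transpose * R = 1 := by
    ext i j
    have := orthonormal_iff_ite.1 b.orthonormal i j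
    rw [Matrix.mul_apply, Matrix.one_apply, ← this]
    simp [R, PiLp.inner_apply, mul_comm]
  refine ⟨R, hR, mul_eq_one_comm.1 hR, fun i => ?_⟩
  have := congrArg (fun w : EuclideanSpace ℝ (Fin (r + 1)) => w i) huv
  simpa [R, hb0] using this

/-! ### The law of the length of a Gaussian vector -/

/-- Polar coordinates for nonnegative radial functions. -/
theorem lintegral_fun_norm_addHaar {E : Type*} [NormedAddCommGroup E] [NormedSpace ℝ E]
    [Nontrivial E] [FiniteDimensional ℝ E] [MeasurableSpace E] [BorelSpace E] (μ : Measure E)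
    [μ.IsAddHaarMeasure] {f : ℝ → ENNReal} (hf : Measurable f) :
    ∫⁻ x, f ‖x‖ ∂μ = μ.toSphere Set.univ *
      ∫⁻ y in Set.Ioi (0 : ℝ), ENNReal.ofReal (y ^ (Module.finrank ℝ E - 1)) * f y := by
  have h1 : ∫⁻ x, f ‖x‖ ∂μ = ∫⁻ x : ({(0)}ᶜ : Set E), f ‖x.1‖ ∂(μ.comap (↑)) := by
    rw [lintegral_subtype_comap (measurableSet_singleton _).compl fun x ↦ f (‖x‖),
      restrict_compl_singleton]
  have h2 := μ.measurePreserving_homeomorphUnitSphereProd.lintegral_comp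
    (f := fun p => f p.2.1) (by fun_prop)
  rw [h1]
  have h3 : ∀ x : ({(0)}ᶜ : Set E), ((homeomorphUnitSphereProd E x).2 : ℝ) = ‖x.1‖ := fun x => by
    simp
  simp only [h3] at h2
  rw [h2, lintegral_prod _ (by fun_prop)]
  simp only [lintegral_const]
  rw [mul_comm, Measure.volumeIoiPow, lintegral_withDensity_eq_lintegral_mul _ (by fun_prop)
    (by fun_prop)]
  congr 1
  exact lintegral_subtype_comap (measurableSet_Ioi) fun x : ℝ =>
    ENNReal.ofReal (x ^ (Module.finrank ℝ E - 1)) * f x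

/-- The density of the standard Gaussian measure, up to normalization. -/
noncomputable def gaussDensity (t : ℝ) : ENNReal := ENNReal.ofReal (Real.exp (-(t ^ 2) / 2))

@[fun_prop]
theorem measurable_gaussDensity : Measurable gaussDensity := by
  unfold gaussDensity; fun_prop

theorem lintegral_pi_prod {n : ℕ} (μ : Measure ℝ) [SigmaFinite μ] (f : Fin n → ℝ → ENNReal)
    (hf : ∀ i, Measurable (f i)) :
    ∫⁻ x, ∏ i, f i (x i) ∂(Measure.pi fun _ : Fin n => μ) = ∏ i, ∫⁻ t, f i t ∂μ := by
  induction n with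
  | zero => simp
  | succ n ih =>
    have h : MeasurePreserving (fun p : ℝ × (Fin n → ℝ) => (Fin.cons p.1 p.2 : Fin (n + 1) → ℝ))
        (μ.prod (Measure.pi fun _ => μ)) (Measure.pi fun _ => μ) := by
      convert (measurePreserving_piFinSuccAbove (fun _ : Fin (n + 1) => μ) 0).symm using 1
      ext p i
      cases i using Fin.cases <;> simp [MeasurableEquiv.piFinSuccAbove_symm_apply]
    rw [← h.lintegral_comp (f := fun x => ∏ i, f i (x i))
      (Finset.measurable_prod _ fun i _ => (hf i).comp (measurable_pi_apply i))]
    simp only [Fin.prod_univ_succ, Fin.cons_zero, Fin.cons_succ]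
    rw [lintegral_prod_mul (f := f 0) (g := fun x : Fin n → ℝ => ∏ i : Fin n, f i.succ (x i))
      (hf 0).aemeasurable (Finset.measurable_prod _ fun i _ =>
        (hf i.succ).comp (measurable_pi_apply i)).aemeasurable, ih _ fun i => hf _]

theorem pi_withDensity_fin {n : ℕ} (μ : Measure ℝ) [SigmaFinite μ] {f : ℝ → ENNReal}
    (hf : Measurable f) [SigmaFinite (μ.withDensity f)] :
    (Measure.pi fun _ : Fin n => μ.withDensity f) =
      (Measure.pi fun _ : Fin n => μ).withDensity fun x => ∏ i, f (x i) := by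
  refine Measure.pi_eq (μ := fun _ : Fin n => μ.withDensity f) fun s hs => ?_
  rw [withDensity_apply _ (MeasurableSet.univ_pi hs), ← lintegral_indicator
    (MeasurableSet.univ_pi hs)]
  have : ∀ x : Fin n → ℝ, (Set.univ.pi s).indicator (fun x => ∏ i, f (x i)) x =
      ∏ i, (s i).indicator f (x i) := fun x => by
    by_cases hx : x ∈ Set.univ.pi s
    · rw [Set.indicator_of_mem hx]
      exact Finset.prod_congr rfl fun i _ => (Set.indicator_of_mem (hx i trivial) _).symm
    · rw [Set.indicator_of_notMem hx]
      obtain ⟨i, hi⟩ : ∃ i, x i ∉ s i := by simpa [Set.mem_pi] using hx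
      exact (Finset.prod_eq_zero (Finset.mem_univ i) (Set.indicator_of_notMem hi _)).symm
  simp only [this]
  rw [lintegral_pi_prod μ (fun i => (s i).indicator f) fun i => hf.indicator (hs i)]
  exact Finset.prod_congr rfl fun i _ => by
    rw [lintegral_indicator (hs i), withDensity_apply _ (hs i)]

theorem gaussianPDF_eq (t : ℝ) : ProbabilityTheory.gaussianPDF 0 1 t =
    ENNReal.ofReal (Real.sqrt (2 * Real.pi))⁻¹ * gaussDensity t := by
  rw [ProbabilityTheory.gaussianPDF, ProbabilityTheory.gaussianPDFReal, gaussDensity,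
    ← ENNReal.ofReal_mul (by positivity)]
  simp

theorem lintegral_gauss (n : ℕ) {f : (Fin n → ℝ) → ENNReal} (hf : Measurable f) :
    ∫⁻ x, f x ∂gauss (Fin n) = ENNReal.ofReal (Real.sqrt (2 * Real.pi))⁻¹ ^ n *
      ∫⁻ x : Fin n → ℝ, gaussDensity (len x) * f x := by
  have h0 : gauss (Fin n) = (volume : Measure (Fin n → ℝ)).withDensity fun x =>
      ∏ i, ProbabilityTheory.gaussianPDF 0 1 (x i) := by
    have : SigmaFinite ((volume : Measure ℝ).withDensity (ProbabilityTheory.gaussianPDF 0 1)) := by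
      rw [← ProbabilityTheory.gaussianReal_of_var_ne_zero _ one_ne_zero]; infer_instance
    rw [volume_pi, ← pi_withDensity_fin _ (ProbabilityTheory.measurable_gaussianPDF 0 1),
      ← ProbabilityTheory.gaussianReal_of_var_ne_zero _ one_ne_zero]
    rfl
  have hm : Measurable fun x : Fin n → ℝ => ∏ i, ProbabilityTheory.gaussianPDF 0 1 (x i) :=
    Finset.measurable_prod _ fun i _ =>
      (ProbabilityTheory.measurable_gaussianPDF 0 1).comp (measurable_pi_apply i)
  rw [h0, lintegral_withDensity_eq_lintegral_mul _ hm hf, ← lintegral_const_mul _ (by fun_prop)]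
  refine lintegral_congr fun x => ?_
  simp only [Pi.mul_apply, gaussianPDF_eq, Finset.prod_mul_distrib, Finset.prod_const,
    Finset.card_univ, Fintype.card_fin]
  rw [mul_assoc]
  congr 2
  simp only [gaussDensity]
  rw [← ENNReal.ofReal_prod_of_nonneg fun _ _ => (Real.exp_pos _).le, ← Real.exp_sum, len_sq,
    ← Finset.sum_div, Finset.sum_neg_distrib]

/-- The law of the length of a Gaussian vector has density proportional to `t ^ n e^{-t²/2}`. -/
theorem exists_lintegral_gauss_len (n : ℕ) : ∃ C : ENNReal, ∀ f : ℝ → ENNReal, Measurable f →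
    ∫⁻ x, f (len x) ∂gauss (Fin (n + 1)) =
      C * ∫⁻ t in Set.Ioi (0 : ℝ), ENNReal.ofReal (t ^ n) * (gaussDensity t * f t) := by
  refine ⟨ENNReal.ofReal (Real.sqrt (2 * Real.pi))⁻¹ ^ (n + 1) *
    (volume : Measure (EuclideanSpace ℝ (Fin (n + 1)))).toSphere Set.univ, fun f hf => ?_⟩
  rw [lintegral_gauss _ (by fun_prop), mul_assoc]
  congr 1
  have h := lintegral_fun_norm_addHaar (volume : Measure (EuclideanSpace ℝ (Fin (n + 1))))
    (f := fun t => gaussDensity t * f t) (by fun_prop)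
  simp only [finrank_euclideanSpace, Fintype.card_fin, Nat.add_sub_cancel] at h
  rw [← h, ← (PiLp.volume_preserving_toLp (Fin (n + 1))).lintegral_comp (by fun_prop)]
  simp only [len_eq_norm]

/-! ### Comparison of lengths in dimensions r and r + 2 -/

/-- The Cauchy–Schwarz inequality for lower Lebesgue integrals. -/
theorem lintegral_mul_sq_le {α : Type*} [MeasurableSpace α] (μ : Measure α) {f g : α → ENNReal}
    (hf : AEMeasurable f μ) (hg : AEMeasurable g μ) :
    (∫⁻ x, f x * g x ∂μ) ^ 2 ≤ (∫⁻ x, f x ^ 2 ∂μ) * ∫⁻ x, g x ^ 2 ∂μ := by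
  have h := ENNReal.lintegral_mul_le_Lp_mul_Lq μ Real.HolderConjugate.two_two hf hg
  calc (∫⁻ x, f x * g x ∂μ) ^ 2
      ≤ ((∫⁻ x, f x ^ (2 : ℝ) ∂μ) ^ (1 / 2 : ℝ) * (∫⁻ x, g x ^ (2 : ℝ) ∂μ) ^ (1 / 2 : ℝ)) ^ 2 := by
        gcongr; exact h
    _ = _ := by
        rw [mul_pow, ← ENNReal.rpow_natCast, ← ENNReal.rpow_natCast, ← ENNReal.rpow_mul,
          ← ENNReal.rpow_mul]
        norm_num

theorem lintegral_sq_le {α : Type*} [MeasurableSpace α] (μ : Measure α) [IsProbabilityMeasure μ]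
    {f : α → ENNReal} (hf : AEMeasurable f μ) :
    (∫⁻ x, f x ∂μ) ^ 2 ≤ ∫⁻ x, f x ^ 2 ∂μ := by
  simpa using lintegral_mul_sq_le μ (f := fun _ => 1) aemeasurable_const hf

theorem lintegral_sq_gaussianReal :
    ∫⁻ t, ENNReal.ofReal (t ^ 2) ∂ProbabilityTheory.gaussianReal 0 1 = 1 := by
  have hi : Integrable (fun t : ℝ => t ^ 2) (ProbabilityTheory.gaussianReal 0 1) :=
    (ProbabilityTheory.memLp_id_gaussianReal 2).integrable_sq
  rw [← ofReal_integral_eq_lintegral_ofReal hi (Filter.Eventually.of_forall fun _ => sq_nonneg _)]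
  have h := ProbabilityTheory.variance_fun_id_gaussianReal (μ := 0) (v := 1)
  rw [ProbabilityTheory.variance_of_integral_eq_zero (by fun_prop) (by simp)] at h
  rw [h]; simp

theorem lintegral_len_sq (r : ℕ) :
    ∫⁻ x, ENNReal.ofReal (len x ^ 2) ∂gauss (Fin r) = r := by
  have h : ∀ x : Fin r → ℝ, ENNReal.ofReal (len x ^ 2) = ∑ i, ENNReal.ofReal (x i ^ 2) := fun x => by
    rw [len_sq, ENNReal.ofReal_sum_of_nonneg fun _ _ => sq_nonneg _]
  simp only [h]
  rw [lintegral_finsetSum _ fun i _ => by fun_prop]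
  have h2 : ∀ i : Fin r, ∫⁻ x, ENNReal.ofReal (x i ^ 2) ∂gauss (Fin r) = 1 := fun i => by
    rw [← lintegral_sq_gaussianReal]
    exact (measurePreserving_eval (fun _ : Fin r => ProbabilityTheory.gaussianReal 0 1)
      i).lintegral_comp (f := fun t => ENNReal.ofReal (t ^ 2)) (by fun_prop)
  simp [h2]

/-- Raising the dimension of a Gaussian vector by two amounts to reweighting the law of its length
by the square. -/
theorem lintegral_gauss_len_add_two {r : ℕ} (hr : 0 < r) {f : ℝ → ENNReal} (hf : Measurable f) :
    r * ∫⁻ x, f (len x) ∂gauss (Fin (r + 2)) =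
      ∫⁻ x, ENNReal.ofReal (len x ^ 2) * f (len x) ∂gauss (Fin r) := by
  obtain ⟨p, rfl⟩ : ∃ p, r = p + 1 := ⟨r - 1, by omega⟩
  obtain ⟨C, hC⟩ := exists_lintegral_gauss_len p
  obtain ⟨D, hD⟩ := exists_lintegral_gauss_len (p + 2)
  set J : (ℝ → ENNReal) → ENNReal := fun f =>
    ∫⁻ t in Set.Ioi (0 : ℝ), ENNReal.ofReal (t ^ (p + 2)) * (gaussDensity t * f t) with hJ
  have h1 : ∀ f, Measurable f → ∫⁻ x, f (len x) ∂gauss (Fin (p + 1 + 2)) = D * J f := hD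
  have h2 : ∀ f : ℝ → ENNReal, Measurable f →
      ∫⁻ x, ENNReal.ofReal (len x ^ 2) * f (len x) ∂gauss (Fin (p + 1)) = C * J f := fun f hf => by
    rw [hC (fun t => ENNReal.ofReal (t ^ 2) * f t) (by fun_prop)]
    congr 1
    refine setLIntegral_congr_fun measurableSet_Ioi fun t ht => ?_
    have ht : 0 < t := ht
    rw [pow_add, ENNReal.ofReal_mul (by positivity)]
    ring
  -- The normalizing constants are never computed: testing with f = 1 and using E|x|² = r determines
  -- their ratio.
  have e1 := h1 (fun _ => 1) measurable_const
  have e2 := h2 (fun _ => 1) measurable_const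
  simp only [lintegral_const, measure_univ, mul_one, lintegral_len_sq] at e1 e2
  have hJ0 : J (fun _ => 1) ≠ 0 := fun h => by simp [h] at e1
  have hD0 : D ≠ 0 := fun h => by simp [h] at e1
  have hJt : J (fun _ => 1) ≠ ⊤ := fun h => by
    rw [h, ENNReal.mul_top hD0] at e1; simp at e1
  have hCD : C = (p + 1 : ℕ) * D := by
    refine (ENNReal.mul_left_inj hJ0 hJt).1 ?_
    rw [← e2, mul_assoc, ← e1, mul_one]
  rw [h1 f hf, h2 f hf, hCD, mul_assoc]

/-- This is the dimension shift applied to t²: E|x|⁴ in dimension r is r times E|x|² in dimension r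
+ 2. -/
theorem lintegral_len_pow_four {r : ℕ} (hr : 0 < r) :
    ∫⁻ x, ENNReal.ofReal (len x ^ 2) ^ 2 ∂gauss (Fin r) = r * (r + 2 : ℕ) := by
  have h := lintegral_gauss_len_add_two hr (f := fun t => ENNReal.ofReal (t ^ 2)) (by fun_prop)
  rw [lintegral_len_sq] at h
  rw [h]
  simp only [sq]

/-- A second-moment comparison of the lengths of Gaussian vectors in dimensions `r` and `r + 2`. -/
theorem sq_lintegral_gauss_len_add_two_le {r : ℕ} (hr : 0 < r) {f : ℝ → ENNReal}
    (hf : Measurable f) :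
    r * (∫⁻ x, f (len x) ∂gauss (Fin (r + 2))) ^ 2 ≤
      (r + 2 : ℕ) * ∫⁻ x, f (len x) ^ 2 ∂gauss (Fin r) := by
  -- Cauchy–Schwarz separates the weight |x|² from f. The fourth moment r(r + 2) then meets r² on
  -- the left, and one factor r cancels.
  have h := lintegral_mul_sq_le (gauss (Fin r)) (f := fun x => ENNReal.ofReal (len x ^ 2))
    (g := fun x => f (len x)) (by fun_prop) (by fun_prop)
  rw [← lintegral_gauss_len_add_two hr hf, lintegral_len_pow_four hr, mul_pow, sq (r : ENNReal),
    mul_assoc, mul_assoc] at h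
  exact (ENNReal.mul_le_mul_iff_right (by simpa using hr.ne') (by simp)).1 h

/-! ### Adaptive functions of a matrix -/

/-- On the set `S` of matrices the value of `f` is determined by `k` adaptive matrix-vector
products. -/
def AdaptiveOn {m : ℕ} {α : Type*} :
    ℕ → Set (Fin m → Fin m → ℝ) → ((Fin m → Fin m → ℝ) → α) → Prop
  | 0, S, f => ∀ A ∈ S, ∀ B ∈ S, f A = f B
  | k + 1, S, f => ∃ v : Fin m → ℝ, ∀ B, AdaptiveOn k
      {A ∈ S | (Matrix.of A).mulVec v = (Matrix.of B).mulVec v} f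

theorem AdaptiveOn.mono {m : ℕ} {α : Type*} {k : ℕ} {S T : Set (Fin m → Fin m → ℝ)}
    {f : (Fin m → Fin m → ℝ) → α} (h : AdaptiveOn k T f) (hST : S ⊆ T) : AdaptiveOn k S f := by
  induction k generalizing S T with
  | zero => exact fun A hA B hB => h A (hST hA) B (hST hB)
  | succ k ih =>
    obtain ⟨v, hv⟩ := h
    exact ⟨v, fun B => ih (hv B) fun A hA => ⟨hST hA.1, hA.2⟩⟩

/-- Adaptive computations are pulled back along maps of matrices whose products with a vector
are determined by one product of the argument. -/
theorem AdaptiveOn.comap {m n : ℕ} {α : Type*} {k : ℕ} {T : Set (Fin m → Fin m → ℝ)}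
    {f : (Fin m → Fin m → ℝ) → α} (h : AdaptiveOn k T f)
    {F : (Fin n → Fin n → ℝ) → (Fin m → Fin m → ℝ)}
    (hF : ∀ v, ∃ w, ∀ A B, (Matrix.of A).mulVec w = (Matrix.of B).mulVec w →
      (Matrix.of (F A)).mulVec v = (Matrix.of (F B)).mulVec v) :
    AdaptiveOn k (F ⁻¹' T) (f ∘ F) := by
  induction k generalizing T with
  | zero => exact fun A hA B hB => h _ hA _ hB
  | succ k ih =>
    obtain ⟨v, hv⟩ := h
    obtain ⟨w, hw⟩ := hF v
    exact ⟨w, fun B => (ih (hv (F B))).mono fun A hA => ⟨hA.1, hw A B hA.2⟩⟩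

theorem AdaptiveOn.comp_right {m : ℕ} {α β : Type*} {k : ℕ} {T : Set (Fin m → Fin m → ℝ)}
    {f : (Fin m → Fin m → ℝ) → α} (h : AdaptiveOn k T f) (φ : α → β) :
    AdaptiveOn k T (φ ∘ f) := by
  induction k generalizing T with
  | zero => exact fun A hA B hB => congrArg φ (h _ hA _ hB)
  | succ k ih =>
    obtain ⟨v, hv⟩ := h
    exact ⟨v, fun B => ih (hv B)⟩

/-! ### Gram matrices and conditioning on one product -/

/-- The Gram matrix `G Gᵀ` of the rows of `G`. -/
def gram {m r : ℕ} (G : Fin m × Fin r → ℝ) : Fin m → Fin m → ℝ :=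
  fun i i' => ∑ j, G (i, j) * G (i', j)

@[fun_prop]
theorem measurable_gram {m r : ℕ} : Measurable (gram : (Fin m × Fin r → ℝ) → _) := by
  unfold gram; fun_prop

/-- The matrix with first row `(x², x h)` and lower right block `h hᵀ + A`. -/
def bordered {m : ℕ} (x : ℝ) (h : Fin m → ℝ) (A : Fin m → Fin m → ℝ) :
    Fin (m + 1) → Fin (m + 1) → ℝ :=
  fun i i' => (Fin.cons x h : Fin (m + 1) → ℝ) i * (Fin.cons x h : Fin (m + 1) → ℝ) i' +
    (Fin.cons 0 (fun j => (Fin.cons 0 (A j) : Fin (m + 1) → ℝ)) :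
      Fin (m + 1) → Fin (m + 1) → ℝ) i i'

theorem measurable_bordered {m : ℕ} :
    Measurable fun p : ℝ × (Fin m → ℝ) × (Fin m → Fin m → ℝ) => bordered p.1 p.2.1 p.2.2 := by
  refine measurable_pi_lambda _ fun i => measurable_pi_lambda _ fun i' => ?_
  unfold bordered
  cases i using Fin.cases <;> cases i' using Fin.cases <;> simp <;> fun_prop

/-- The inner block meets only the last m coordinates of v, so a query to the bordered matrix costs
just one query to the block. -/
theorem bordered_mulVec {m : ℕ} (x : ℝ) (h : Fin m → ℝ) (A B : Fin m → Fin m → ℝ)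
    (v : Fin (m + 1) → ℝ) (hAB : (Matrix.of A).mulVec (fun i => v i.succ) =
      (Matrix.of B).mulVec (fun i => v i.succ)) :
    (Matrix.of (bordered x h A)).mulVec v = (Matrix.of (bordered x h B)).mulVec v := by
  ext i
  cases i using Fin.cases with
  | zero => simp [Matrix.mulVec, dotProduct, bordered, Fin.sum_univ_succ]
  | succ i =>
    have := congrFun hAB i
    simp only [Matrix.mulVec, dotProduct, Matrix.of_apply] at this
    simp [Matrix.mulVec, dotProduct, bordered, Fin.sum_univ_succ, add_mul, Finset.sum_add_distrib,
      this]

/-- After one product with `e₀` has been made, the remaining products only concern the lower right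
block. -/
theorem AdaptiveOn.bordered {m k : ℕ} {α : Type*} {f : (Fin (m + 1) → Fin (m + 1) → ℝ) → α}
    (hf : ∀ B : Fin (m + 1) → Fin (m + 1) → ℝ, AdaptiveOn k {A | (Matrix.of A).mulVec (Pi.single 0 1) =
      (Matrix.of B).mulVec (Pi.single 0 1)} f) (x : ℝ) (h : Fin m → ℝ) :
    AdaptiveOn k Set.univ (fun A => f (bordered x h A)) := by
  -- The column at e₀ is (x², xh) whatever the block is, so all these matrices lie in one answer
  -- class, represented by the zero block.
  refine ((hf (_root_.bordered x h 0)).comap (F := _root_.bordered x h) fun v =>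
    ⟨fun i => v i.succ, fun A B hAB => bordered_mulVec x h A B v hAB⟩).mono fun A _ => ?_
  simp only [Matrix.mulVec_single_one, Set.mem_preimage, Set.mem_ofPred_eq]
  ext i
  cases i using Fin.cases <;> simp [_root_.bordered, Matrix.col]

/-- Multiplication of `G` by `R` on the right. -/
def mulRight {m r : ℕ} (R : Matrix (Fin r) (Fin r) ℝ) :
    (Fin m × Fin r → ℝ) →ₗ[ℝ] (Fin m × Fin r → ℝ) where
  toFun G p := ∑ j, G (p.1, j) * R j p.2
  map_add' G H := by ext p; simp [add_mul, Finset.sum_add_distrib]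
  map_smul' c G := by ext p; simp [Finset.mul_sum, mul_assoc]

/-- Multiplication of `G` by `Q` on the left. -/
def mulLeft {m r : ℕ} (Q : Matrix (Fin m) (Fin m) ℝ) :
    (Fin m × Fin r → ℝ) →ₗ[ℝ] (Fin m × Fin r → ℝ) where
  toFun G p := ∑ i, Q p.1 i * G (i, p.2)
  map_add' G H := by ext p; simp [mul_add, Finset.sum_add_distrib]
  map_smul' c G := by ext p; simp [Finset.mul_sum, mul_left_comm]

/-- `A ↦ Q A Qᵀ`. -/
def conjBy {m : ℕ} (Q : Matrix (Fin m) (Fin m) ℝ) (A : Fin m → Fin m → ℝ) : Fin m → Fin m → ℝ :=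
  Q * Matrix.of A * Q.transpose

theorem dotProduct_vecMul_orthogonal {r : ℕ} {R : Matrix (Fin r) (Fin r) ℝ}
    (hR : R * R.transpose = 1) (u v : Fin r → ℝ) :
    Matrix.vecMul u R ⬝ᵥ Matrix.vecMul v R = u ⬝ᵥ v := by
  rw [← Matrix.mulVec_transpose R v, ← Matrix.dotProduct_mulVec, Matrix.mulVec_mulVec, hR,
    Matrix.one_mulVec]

theorem measurePreserving_mulRight {m r : ℕ} {R : Matrix (Fin r) (Fin r) ℝ}
    (hR : R * R.transpose = 1) :
    MeasurePreserving (mulRight R) (gauss (Fin m × Fin r)) (gauss (Fin m × Fin r)) := by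
  refine measurePreserving_gauss_of_isometry rfl _ fun G => ?_
  rw [Fintype.sum_prod_type, Fintype.sum_prod_type]
  refine Finset.sum_congr rfl fun i _ => ?_
  have := dotProduct_vecMul_orthogonal hR (fun j => G (i, j)) (fun j => G (i, j))
  simpa [dotProduct, Matrix.vecMul, mulRight, sq] using this

theorem measurePreserving_mulLeft {m r : ℕ} {Q : Matrix (Fin m) (Fin m) ℝ}
    (hQ : Q.transpose * Q = 1) :
    MeasurePreserving (mulLeft Q) (gauss (Fin m × Fin r)) (gauss (Fin m × Fin r)) := by
  refine measurePreserving_gauss_of_isometry rfl _ fun G => ?_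
  rw [Fintype.sum_prod_type_right, Fintype.sum_prod_type_right]
  refine Finset.sum_congr rfl fun j _ => ?_
  have := dotProduct_vecMul_orthogonal (R := Q.transpose) (by simpa using hQ)
    (fun i => G (i, j)) (fun i => G (i, j))
  simpa [dotProduct, Matrix.vecMul, mulLeft, sq, mul_comm] using this

theorem of_gram {m r : ℕ} (G : Fin m × Fin r → ℝ) : Matrix.of (gram G) =
    (Matrix.of fun i j => G (i, j)) * (Matrix.of fun i j => G (i, j)).transpose := by
  ext i i'; simp [gram, Matrix.mul_apply]

theorem gram_mulLeft {m r : ℕ} (Q : Matrix (Fin m) (Fin m) ℝ) (G : Fin m × Fin r → ℝ) :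
    gram (mulLeft Q G) = conjBy Q (gram G) := by
  have h2 : (Matrix.of fun i j => mulLeft Q G (i, j)) = Q * Matrix.of fun i j => G (i, j) := by
    ext i j; simp [mulLeft, Matrix.mul_apply]
  refine Matrix.of.injective ?_
  rw [of_gram, h2, Matrix.transpose_mul, conjBy, of_gram G, Matrix.mul_assoc, Matrix.mul_assoc,
    Matrix.mul_assoc]
  rfl

theorem gram_mulRight {m r : ℕ} {R : Matrix (Fin r) (Fin r) ℝ} (hR : R * R.transpose = 1)
    (G : Fin m × Fin r → ℝ) : gram (mulRight R G) = gram G := by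
  ext i i'
  have := dotProduct_vecMul_orthogonal hR (fun j => G (i, j)) (fun j => G (i', j))
  simpa [dotProduct, Matrix.vecMul, mulRight, gram] using this

theorem measurable_conjBy {m : ℕ} (Q : Matrix (Fin m) (Fin m) ℝ) : Measurable (conjBy Q) := by
  refine measurable_pi_lambda _ fun i => measurable_pi_lambda _ fun j => ?_
  simp only [conjBy, Matrix.mul_apply, Matrix.of_apply]
  fun_prop

theorem conjBy_mulVec {m : ℕ} {Q : Matrix (Fin m) (Fin m) ℝ} (v : Fin m → ℝ)
    (A B : Fin m → Fin m → ℝ) (h : (Matrix.of A).mulVec (Q.transpose.mulVec v) =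
      (Matrix.of B).mulVec (Q.transpose.mulVec v)) :
    (Matrix.of (conjBy Q A)).mulVec v = (Matrix.of (conjBy Q B)).mulVec v := by
  have e : ∀ A, (Matrix.of (conjBy Q A)).mulVec v =
      Q.mulVec ((Matrix.of A).mulVec (Q.transpose.mulVec v)) := fun A => by
    rw [Matrix.mulVec_mulVec, Matrix.mulVec_mulVec]; rfl
  rw [e, e, h]

/-- Splitting off the first row of a matrix. -/
def splitRow (m r : ℕ) : Fin (m + 1) × Fin r ≃ Fin r ⊕ Fin m × Fin r where
  toFun p := Fin.cases (motive := fun _ => Fin r ⊕ Fin m × Fin r)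
    (Sum.inl p.2) (fun i => Sum.inr (i, p.2)) p.1
  invFun := Sum.elim (fun j => (0, j)) fun q => (q.1.succ, q.2)
  left_inv := fun ⟨i, j⟩ => by cases i using Fin.cases <;> rfl
  right_inv := fun s => by rcases s with j | q <;> rfl

/-- Splitting off the first column of a matrix. -/
def splitCol (m r : ℕ) : Fin m × Fin (r + 1) ≃ Fin m ⊕ Fin m × Fin r where
  toFun p := Fin.cases (motive := fun _ => Fin m ⊕ Fin m × Fin r)
    (Sum.inl p.1) (fun j => Sum.inr (p.1, j)) p.2
  invFun := Sum.elim (fun i => (i, 0)) fun q => (q.1, q.2.succ)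
  left_inv := fun ⟨i, j⟩ => by cases j using Fin.cases <;> rfl
  right_inv := fun s => by rcases s with j | q <;> rfl

/-- Products with `g` only involve the first column after a rotation taking `|g| e₀` to `g`. -/
theorem sum_mulRight_mul {m r : ℕ} {R : Matrix (Fin (r + 1)) (Fin (r + 1)) ℝ}
    (hR : R.transpose * R = 1) {g : Fin (r + 1) → ℝ} (hg : ∀ i, g i = len g * R i 0)
    (h : Fin m → ℝ) (G : Fin m × Fin r → ℝ) (i : Fin m) :
    ∑ j, mulRight R.transpose (Sum.elim h G ∘ splitCol m r) (i, j) * g j = len g * h i := by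
  have hcol : ∀ l, ∑ j, R j l * g j = if l = 0 then len g else 0 := fun l => by
    have := congrFun (congrFun hR 0) l
    simp only [Matrix.mul_apply, Matrix.transpose_apply, Matrix.one_apply] at this
    calc ∑ j, R j l * g j = len g * ∑ j, R j 0 * R j l := by
          rw [Finset.mul_sum]; exact Finset.sum_congr rfl fun j _ => by rw [hg j]; ring
      _ = _ := by rw [this]; simp [eq_comm]
  simp only [mulRight, LinearMap.coe_mk, AddHom.coe_mk, Matrix.transpose_apply, Finset.sum_mul]
  rw [Finset.sum_comm]
  calc _ = ∑ l, (Sum.elim h G ∘ splitCol m r) (i, l) * ∑ j, R j l * g j := by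
        refine Finset.sum_congr rfl fun l _ => ?_
        rw [Finset.mul_sum]; exact Finset.sum_congr rfl fun j _ => by ring
    _ = _ := by simp only [hcol]; simp [splitCol, mul_comm]

theorem lintegral_gauss_mulRight {m r : ℕ} {R : Matrix (Fin (r + 1)) (Fin (r + 1)) ℝ}
    (hR : R.transpose * R = 1) {f : (Fin m × Fin (r + 1) → ℝ) → ENNReal} (hf : Measurable f) :
    ∫⁻ G, f G ∂gauss (Fin m × Fin (r + 1)) =
      ∫⁻ h, ∫⁻ G, f (mulRight R.transpose (Sum.elim h G ∘ splitCol m r))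
        ∂gauss (Fin m × Fin r) ∂gauss (Fin m) := by
  have h := measurePreserving_mulRight (m := m) (R := R.transpose) (by simpa using hR)
  rw [← h.lintegral_comp hf]
  exact lintegral_gauss_split (splitCol m r) (hf.comp h.measurable)

/-- Right multiplication of the lower rows by Rᵀ leaves their mutual inner products unchanged, and
their inner products with g see only the column h, scaled by |g|. -/
theorem gram_eq_bordered {m r : ℕ} {R : Matrix (Fin (r + 1)) (Fin (r + 1)) ℝ}
    (hR : R.transpose * R = 1) {g : Fin (r + 1) → ℝ} (hg : ∀ i, g i = len g * R i 0)
    (h : Fin m → ℝ) (G : Fin m × Fin r → ℝ) :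
    gram (Sum.elim g (mulRight R.transpose (Sum.elim h G ∘ splitCol m r)) ∘ splitRow m (r + 1)) =
      bordered (len g) h (gram G) := by
  have hdot := sum_mulRight_mul hR hg h G
  ext i i'
  cases i using Fin.cases with
  | zero =>
    cases i' using Fin.cases with
    | zero => simpa [gram, bordered, splitRow, ← sq] using (len_sq g).symm
    | succ i' => simpa [gram, bordered, splitRow, mul_comm] using hdot i'
  | succ i =>
    cases i' using Fin.cases with
    | zero => simpa [gram, bordered, splitRow, mul_comm] using hdot i
    | succ i' =>
      have := congrFun (congrFun (gram_mulRight (R := R.transpose) (by simpa using hR)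
        (Sum.elim h G ∘ splitCol m r)) i) i'
      simp only [gram] at this
      simp only [gram, bordered, splitRow, Function.comp, Equiv.coe_fn_mk, Fin.cases_succ,
        Sum.elim_inr, Fin.cons_succ]
      rw [this]
      simp [splitCol, Fin.sum_univ_succ]

/-- Conditioning a Wishart matrix on its product with `e₀`. -/
theorem lintegral_gram_succ {m r : ℕ} {f : (Fin (m + 1) → Fin (m + 1) → ℝ) → ENNReal}
    (hf : Measurable f) :
    ∫⁻ G, f (gram G) ∂gauss (Fin (m + 1) × Fin (r + 1)) =
      ∫⁻ g, ∫⁻ h, ∫⁻ G, f (bordered (len g) h (gram G))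
        ∂gauss (Fin m × Fin r) ∂gauss (Fin m) ∂gauss (Fin (r + 1)) := by
  rw [lintegral_gauss_split (splitRow m (r + 1)) (by fun_prop)]
  refine lintegral_congr fun g => ?_
  -- The rotation is chosen after g has been fixed, inside the outer integral, so it need not depend
  -- measurably on g.
  obtain ⟨R, hR, -, hg⟩ := exists_orthogonal_mulVec g
  have hm : Measurable fun G2 : Fin m × Fin (r + 1) → ℝ =>
      f (gram (Sum.elim g G2 ∘ splitRow m (r + 1))) := by
    refine (hf.comp measurable_gram).comp (measurable_pi_lambda _ fun p => ?_)
    simp only [Function.comp]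
    rcases splitRow m (r + 1) p with j | q
    · simp
    · simp only [Sum.elim_inr]; fun_prop
  rw [lintegral_gauss_mulRight hR hm]
  simp only [gram_eq_bordered hR hg]

/-- Q(GGᵀ)Qᵀ is the Gram matrix of QG, which has the same law as G. -/
theorem lintegral_gram_conjBy {m r : ℕ} {Q : Matrix (Fin m) (Fin m) ℝ} (hQ : Q.transpose * Q = 1)
    {f : (Fin m → Fin m → ℝ) → ENNReal} (hf : Measurable f) :
    ∫⁻ G, f (conjBy Q (gram G)) ∂gauss (Fin m × Fin r) =
      ∫⁻ G, f (gram G) ∂gauss (Fin m × Fin r) := by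
  rw [← (measurePreserving_mulLeft hQ).lintegral_comp (f := fun G => f (gram G)) (by fun_prop)]
  simp only [gram_mulLeft]

/-- After a rotation, the first of several adaptive products is with `e₀`. -/
theorem AdaptiveOn.exists_conjBy {m k : ℕ} {α : Type*}
    {f : (Fin (m + 1) → Fin (m + 1) → ℝ) → α} (hf : AdaptiveOn (k + 1) Set.univ f) :
    ∃ Q : Matrix (Fin (m + 1)) (Fin (m + 1)) ℝ, Q.transpose * Q = 1 ∧
      ∀ B : Fin (m + 1) → Fin (m + 1) → ℝ, AdaptiveOn k {A | (Matrix.of A).mulVec (Pi.single 0 1) =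
        (Matrix.of B).mulVec (Pi.single 0 1)} (fun A => f (conjBy Q A)) := by
  obtain ⟨v, hv⟩ := hf
  obtain ⟨Q, hQ, -, hQv⟩ := exists_orthogonal_mulVec v
  refine ⟨Q, hQ, fun B => ((hv (conjBy Q B)).comap (F := conjBy Q)
    fun w => ⟨_, conjBy_mulVec w⟩).mono fun A hA => ⟨trivial, conjBy_mulVec v A B ?_⟩⟩
  have : Q.transpose.mulVec v = len v • Pi.single 0 1 := by
    have h : v = len v • Q.mulVec (Pi.single 0 1) := by
      ext i; simp [Matrix.col, hQv i]
    conv_lhs => rw [h]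
    rw [Matrix.mulVec_smul, Matrix.mulVec_mulVec, hQ, Matrix.one_mulVec]
  rw [this, Matrix.mulVec_smul, Matrix.mulVec_smul, hA]

/-! ### Indistinguishability of Wishart matrices under adaptive queries -/

/-- Adaptive queries distinguish Wishart matrices of ranks `s + k` and `s + k + 2` only slightly. -/
theorem sq_lintegral_gram_le (k s m : ℕ) {f : (Fin (m + k) → Fin (m + k) → ℝ) → ENNReal}
    (hf : Measurable f) (ha : AdaptiveOn k Set.univ f) :
    ((s + 2) * (s + 1) : ℕ) * (∫⁻ G, f (gram G) ∂gauss (Fin (m + k) × Fin (s + k + 2))) ^ 2 ≤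
      ((s + k + 2) * (s + k + 1) : ℕ) *
        ∫⁻ G, f (gram G) ^ 2 ∂gauss (Fin (m + k) × Fin (s + k)) := by
  induction k with
  | zero =>
    have h : ∀ A, f A = f 0 := fun A => ha A trivial 0 trivial
    simp [h]
  | succ k ih =>
    obtain ⟨Q, hQ, hB⟩ := AdaptiveOn.exists_conjBy (m := m + k) ha
    change ((s + 2) * (s + 1) : ℕ) *
      (∫⁻ G, f (gram G) ∂gauss (Fin (m + k + 1) × Fin (s + k + 2 + 1))) ^ 2 ≤
      ((s + k + 1 + 2) * (s + k + 1 + 1) : ℕ) *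
        ∫⁻ G, f (gram G) ^ 2 ∂gauss (Fin (m + k + 1) × Fin (s + k + 1))
    rw [← lintegral_gram_conjBy hQ hf, ← lintegral_gram_conjBy hQ (f := fun A => f A ^ 2)
      (by fun_prop)]
    set F : (Fin (m + k + 1) → Fin (m + k + 1) → ℝ) → ENNReal := fun A => f (conjBy Q A) with hF
    have hFm : Measurable F := hf.comp (measurable_conjBy Q)
    change _ * (∫⁻ G, F (gram G) ∂_) ^ 2 ≤ _ * ∫⁻ G, F (gram G) ^ 2 ∂_
    rw [lintegral_gram_succ hFm, lintegral_gram_succ (f := fun A => F A ^ 2) (by fun_prop)]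
    have hmeas : ∀ p : ℕ, Measurable fun z : (ℝ × (Fin (m + k) → ℝ)) × (Fin (m + k) × Fin p → ℝ) =>
        F (bordered z.1.1 z.1.2 (gram z.2)) := fun p => by
      have : Measurable fun z : (ℝ × (Fin (m + k) → ℝ)) × (Fin (m + k) × Fin p → ℝ) =>
          (z.1.1, z.1.2, gram z.2) := by fun_prop
      exact hFm.comp (measurable_bordered.comp this)
    set Φ : ℝ → (Fin (m + k) → ℝ) → ENNReal := fun x h =>
      ∫⁻ G, F (bordered x h (gram G)) ∂gauss (Fin (m + k) × Fin (s + k + 2)) with hΦ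
    set Ψ : ℝ → (Fin (m + k) → ℝ) → ENNReal := fun x h =>
      ∫⁻ G, F (bordered x h (gram G)) ^ 2 ∂gauss (Fin (m + k) × Fin (s + k)) with hΨ
    have hΦm : Measurable (Function.uncurry Φ) := (hmeas _).lintegral_prod_right'
    have hΨm : Measurable (Function.uncurry Ψ) := ((hmeas _).pow_const 2).lintegral_prod_right'
    have hΦΨ : ∀ x h, ((s + 2) * (s + 1) : ℕ) * Φ x h ^ 2 ≤
        ((s + k + 2) * (s + k + 1) : ℕ) * Ψ x h := fun x h =>
      ih (hFm.comp (measurable_bordered.comp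
        (measurable_const.prodMk (measurable_const.prodMk measurable_id))))
        (AdaptiveOn.bordered hB x h)
    -- The length |g| costs the factor (r + 2)/r with r = s + k + 1. Jensen moves the square inside
    -- the integral over h, where the induction hypothesis applies for each fixed x and h.
    have h1 := sq_lintegral_gauss_len_add_two_le (r := s + k + 1) (by omega)
      (f := fun x => ∫⁻ h, Φ x h ∂gauss (Fin (m + k))) hΦm.lintegral_prod_right'
    have h2 : ∀ x, (∫⁻ h, Φ x h ∂gauss (Fin (m + k))) ^ 2 ≤
        ∫⁻ h, Φ x h ^ 2 ∂gauss (Fin (m + k)) := fun x =>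
      lintegral_sq_le _ (hΦm.comp measurable_prodMk_left).aemeasurable
    have h3 : ((s + 2) * (s + 1) : ℕ) * ∫⁻ g, (∫⁻ h, Φ (len g) h ∂gauss (Fin (m + k))) ^ 2
          ∂gauss (Fin (s + k + 1)) ≤ ((s + k + 2) * (s + k + 1) : ℕ) *
        ∫⁻ g, ∫⁻ h, Ψ (len g) h ∂gauss (Fin (m + k)) ∂gauss (Fin (s + k + 1)) := by
      rw [← lintegral_const_mul' _ _ (ENNReal.natCast_ne_top _), ← lintegral_const_mul' _ _ (ENNReal.natCast_ne_top _)]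
      refine lintegral_mono fun g => ?_
      refine (mul_le_mul_right (h2 (len g)) _).trans ?_
      rw [← lintegral_const_mul' _ _ (ENNReal.natCast_ne_top _), ← lintegral_const_mul' _ _ (ENNReal.natCast_ne_top _)]
      exact lintegral_mono fun h => hΦΨ _ _
    set X := ∫⁻ g, ∫⁻ h, Φ (len g) h ∂gauss (Fin (m + k)) ∂gauss (Fin (s + k + 2 + 1))
    set Y := ∫⁻ g, (∫⁻ h, Φ (len g) h ∂gauss (Fin (m + k))) ^ 2 ∂gauss (Fin (s + k + 1))
    set Z := ∫⁻ g, ∫⁻ h, Ψ (len g) h ∂gauss (Fin (m + k)) ∂gauss (Fin (s + k + 1))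
    change ((s + k + 1 : ℕ) : ENNReal) * X ^ 2 ≤ (s + k + 1 + 2 : ℕ) * Y at h1
    -- The factor s + k + 1 occurs in the length comparison on the left and in the inductive
    -- constant on the right; cancelling it is the telescoping.
    have h4 : ((s + k + 1 : ℕ) : ENNReal) * (((s + 2) * (s + 1) : ℕ) * X ^ 2) ≤
        (s + k + 1 : ℕ) * (((s + k + 1 + 2) * (s + k + 1 + 1) : ℕ) * Z) := by
      calc ((s + k + 1 : ℕ) : ENNReal) * (((s + 2) * (s + 1) : ℕ) * X ^ 2)
          = ((s + 2) * (s + 1) : ℕ) * ((s + k + 1 : ℕ) * X ^ 2) := by ring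
        _ ≤ ((s + 2) * (s + 1) : ℕ) * ((s + k + 1 + 2 : ℕ) * Y) := by gcongr
        _ = (s + k + 1 + 2 : ℕ) * (((s + 2) * (s + 1) : ℕ) * Y) := by ring
        _ ≤ (s + k + 1 + 2 : ℕ) * (((s + k + 2) * (s + k + 1) : ℕ) * Z) := by gcongr
        _ = _ := by push_cast; ring
    exact (ENNReal.mul_le_mul_iff_right (by simp) (by simp)).1 h4

/-! ### Algorithms as adaptive functions -/

namespace MatVecAlgorithm

variable {Ω : Type*} [MeasurableSpace Ω] {n k : ℕ}

/-- Here d counts the remaining queries. On a class with equal answers so far the next query vector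
is constant, and the next answer refines the class. -/
theorem adaptiveOn_answers (alg : MatVecAlgorithm Ω n k) (ω : Ω) (d i : ℕ) (h : i + d = k)
    (B : Fin n → Fin n → ℝ) :
    AdaptiveOn d {A | alg.answers (Matrix.of A) ω i = alg.answers (Matrix.of B) ω i}
      (fun A => alg.answers (Matrix.of A) ω k) := by
  induction d generalizing i B with
  | zero =>
    subst h
    exact fun A hA A' hA' => hA.trans hA'.symm
  | succ d ih =>
    refine ⟨alg.query i ω (alg.answers (Matrix.of B) ω i), fun C => ?_⟩
    rcases Set.eq_empty_or_nonempty {A | A ∈ {A : Fin n → Fin n → ℝ |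
        alg.answers (Matrix.of A) ω i = alg.answers (Matrix.of B) ω i} ∧
      (Matrix.of A).mulVec (alg.query i ω (alg.answers (Matrix.of B) ω i)) =
        (Matrix.of C).mulVec (alg.query i ω (alg.answers (Matrix.of B) ω i))} with he | ⟨A', hA'⟩
    -- No matrix of the class gives this answer, so the claim is vacuous and the representative is
    -- arbitrary.
    · rw [he]
      exact (ih (i + 1) (by omega) B).mono (Set.empty_subset _)
    · refine (ih (i + 1) (by omega) A').mono fun A hA => ?_
      have h1 : alg.answers (Matrix.of A) ω i = alg.answers (Matrix.of B) ω i := hA.1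
      have h2 : alg.answers (Matrix.of A') ω i = alg.answers (Matrix.of B) ω i := hA'.1
      change alg.answers (Matrix.of A) ω (i + 1) = alg.answers (Matrix.of A') ω (i + 1)
      rw [answers, answers, h1, h2, hA.2, hA'.2]

/-- The output of an algorithm making `k` queries is an adaptive function of the input. -/
theorem adaptiveOn_run (alg : MatVecAlgorithm Ω n k) (ω : Ω) :
    AdaptiveOn k Set.univ (fun A => alg.run (Matrix.of A) ω) :=
  ((alg.adaptiveOn_answers ω k 0 (zero_add k) 0).mono fun _ _ => rfl).comp_right (alg.output ω)

theorem measurable_answers (alg : MatVecAlgorithm Ω n k) (i : ℕ) :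
    Measurable fun p : (Fin n → Fin n → ℝ) × Ω => alg.answers (Matrix.of p.1) p.2 i := by
  induction i with
  | zero => exact measurable_pi_lambda _ fun j => j.elim0
  | succ i ih =>
    refine measurable_pi_lambda _ fun j => ?_
    cases j using Fin.lastCases with
    | last =>
      simp only [answers, Fin.snoc_last]
      have hq : Measurable fun p : (Fin n → Fin n → ℝ) × Ω =>
          alg.query i p.2 (alg.answers (Matrix.of p.1) p.2 i) :=
        (alg.measurable_query i).comp (measurable_snd.prodMk ih)
      refine measurable_pi_lambda _ fun l => ?_
      simp only [Matrix.mulVec, dotProduct, Matrix.of_apply]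
      refine Finset.measurable_sum _ fun j _ => Measurable.mul (by fun_prop) ?_
      exact (measurable_pi_apply j).comp hq
    | cast j =>
      simp only [answers, Fin.snoc_castSucc]
      exact (measurable_pi_apply j).comp ih

theorem measurable_run (alg : MatVecAlgorithm Ω n k) :
    Measurable fun p : (Fin n → Fin n → ℝ) × Ω => alg.run (Matrix.of p.1) p.2 :=
  alg.measurable_output.comp (measurable_snd.prodMk (alg.measurable_answers k))

end MatVecAlgorithm

/-! ### Extreme singular values of tall Gaussian matrices -/

/-- A lower bound on a nonnegative function over a ball around some centre cannot hold with large
probability if the mean of the function is small. -/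
theorem measure_mul_le_of_ball {Ω E : Type*} [MeasurableSpace Ω] (μ : Measure Ω) [SFinite μ]
    [NormedAddCommGroup E] [NormedSpace ℝ E] [FiniteDimensional ℝ E] [MeasurableSpace E]
    [BorelSpace E] {S : Set E} (hS : MeasurableSet S) {ρ η : ℝ} (hη : 0 < η) (hρ : 0 < ρ)
    (hSρ : S ⊆ Metric.ball 0 ρ) {F : Ω → E → ENNReal} (hF : Measurable (Function.uncurry F))
    {L U : ENNReal} (hU : ∀ x ∈ S, ∫⁻ ω, F ω x ∂μ ≤ U) {bad : Set Ω}
    (hbad : ∀ ω ∈ bad, ∃ c, Metric.ball c η ⊆ S ∧ ∀ x ∈ Metric.ball c η, L ≤ F ω x) :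
    ENNReal.ofReal (η ^ Module.finrank ℝ E) * L * μ bad ≤
      ENNReal.ofReal (ρ ^ Module.finrank ℝ E) * U := by
  let ν : Measure E := Measure.addHaar
  set V := ν (Metric.ball 0 1) with hV
  have hV0 : V ≠ 0 := (Metric.measure_ball_pos ν 0 one_pos).ne'
  have hVt : V ≠ ⊤ := measure_ball_lt_top.ne
  have h1 : ∀ ω ∈ bad, ENNReal.ofReal (η ^ Module.finrank ℝ E) * L * V ≤ ∫⁻ x in S, F ω x ∂ν := by
    intro ω hω
    obtain ⟨c, hc, hL⟩ := hbad ω hω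
    calc ENNReal.ofReal (η ^ Module.finrank ℝ E) * L * V = L * ν (Metric.ball c η) := by
          rw [Measure.addHaar_ball_of_pos _ _ hη]; ring
      _ = ∫⁻ x in Metric.ball c η, L ∂ν := by simp
      _ ≤ ∫⁻ x in Metric.ball c η, F ω x ∂ν := setLIntegral_mono' measurableSet_ball hL
      _ ≤ _ := lintegral_mono_set hc
  have h2 : ENNReal.ofReal (η ^ Module.finrank ℝ E) * L * V * μ bad ≤
      ∫⁻ ω, ∫⁻ x in S, F ω x ∂ν ∂μ := by
    -- Markov's inequality for the integral of F over S; averaging over x in this way replaces a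
    -- union bound over a net.
    refine le_trans ?_ (mul_meas_ge_le_lintegral (hF.lintegral_prod_right' (ν := ν.restrict S))
      (ENNReal.ofReal (η ^ Module.finrank ℝ E) * L * V))
    gcongr
    exact fun ω hω => h1 ω hω
  have h3 : ∫⁻ ω, ∫⁻ x in S, F ω x ∂ν ∂μ ≤ ENNReal.ofReal (ρ ^ Module.finrank ℝ E) * U * V := by
    rw [lintegral_lintegral_swap hF.aemeasurable]
    calc ∫⁻ x in S, ∫⁻ ω, F ω x ∂μ ∂ν ≤ ∫⁻ x in S, U ∂ν := setLIntegral_mono' hS hU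
      _ = U * ν S := by simp
      _ ≤ U * ν (Metric.ball 0 ρ) := by gcongr
      _ = _ := by rw [Measure.addHaar_ball_of_pos _ _ hρ]; ring
  refine (ENNReal.mul_le_mul_iff_left hV0 hVt).1 ?_
  calc _ = ENNReal.ofReal (η ^ Module.finrank ℝ E) * L * V * μ bad := by ring
    _ ≤ _ := h2.trans h3

theorem lintegral_exp_neg_mul_sq_gaussianReal {a : ℝ} (ha : -1 / 2 < a) :
    ∫⁻ t, ENNReal.ofReal (Real.exp (-a * t ^ 2)) ∂ProbabilityTheory.gaussianReal 0 1 =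
      ENNReal.ofReal (Real.sqrt (1 / (1 + 2 * a))) := by
  rw [ProbabilityTheory.gaussianReal_of_var_ne_zero _ one_ne_zero,
    lintegral_withDensity_eq_lintegral_mul _ (ProbabilityTheory.measurable_gaussianPDF 0 1)
      (by fun_prop)]
  have h : ∀ t : ℝ, (ProbabilityTheory.gaussianPDF 0 1 * fun t => ENNReal.ofReal
      (Real.exp (-a * t ^ 2))) t =
      ENNReal.ofReal ((Real.sqrt (2 * Real.pi))⁻¹ * Real.exp (-(a + 1 / 2) * t ^ 2)) := fun t => by
    simp only [Pi.mul_apply]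
    rw [gaussianPDF_eq, gaussDensity, mul_assoc, ← ENNReal.ofReal_mul (Real.exp_pos _).le,
      ← ENNReal.ofReal_mul (by positivity), ← Real.exp_add]
    ring_nf
  simp only [h]
  rw [← ofReal_integral_eq_lintegral_ofReal
    ((integrable_exp_neg_mul_sq (by linarith)).const_mul _)
    (Filter.Eventually.of_forall fun _ => by positivity), integral_const_mul, integral_gaussian,
    ← Real.sqrt_inv, ← Real.sqrt_mul (by positivity)]
  congr 2
  rw [show 1 + 2 * a = 2 * (a + 1 / 2) by ring]
  have : a + 1 / 2 ≠ 0 := by linarith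
  field_simp

theorem lintegral_exp_neg_mul_len_sq (n : ℕ) {a : ℝ} (ha : -1 / 2 < a) :
    ∫⁻ h, ENNReal.ofReal (Real.exp (-a * len h ^ 2)) ∂gauss (Fin n) =
      ENNReal.ofReal (Real.sqrt (1 / (1 + 2 * a))) ^ n := by
  have h : ∀ x : Fin n → ℝ, ENNReal.ofReal (Real.exp (-a * len x ^ 2)) =
      ∏ i, ENNReal.ofReal (Real.exp (-a * x i ^ 2)) := fun x => by
    rw [← ENNReal.ofReal_prod_of_nonneg fun _ _ => (Real.exp_pos _).le, ← Real.exp_sum, len_sq,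
      Finset.mul_sum]
  simp only [h]
  rw [gauss, lintegral_pi_prod _ (fun _ t => ENNReal.ofReal (Real.exp (-a * t ^ 2)))
    fun _ => by fun_prop]
  rw [Finset.prod_const, lintegral_exp_neg_mul_sq_gaussianReal ha, Finset.card_univ,
    Fintype.card_fin]

/-- The action of `G` on vectors. -/
noncomputable def act {n q : ℕ} (G : Fin n × Fin q → ℝ) :
    EuclideanSpace ℝ (Fin q) →ₗ[ℝ] EuclideanSpace ℝ (Fin n) where
  toFun x := WithLp.toLp 2 fun i => ∑ j, G (i, j) * x j
  map_add' x y := by ext i; simp [mul_add, Finset.sum_add_distrib]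
  map_smul' c x := by ext i; simp [Finset.mul_sum, mul_left_comm]

theorem norm_act_sq {n q : ℕ} (G : Fin n × Fin q → ℝ) (x : EuclideanSpace ℝ (Fin q)) :
    ‖act G x‖ ^ 2 = ∑ i, (∑ j, G (i, j) * x j) ^ 2 := by
  simp [EuclideanSpace.norm_sq_eq, act]

theorem measurable_norm_act {n q : ℕ} :
    Measurable fun p : (Fin n × Fin q → ℝ) × EuclideanSpace ℝ (Fin q) => ‖act p.1 p.2‖ ^ 2 := by
  simp only [norm_act_sq]
  fun_prop

/-- For a fixed vector `x`, `G x / |x|` is a standard Gaussian vector. -/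
theorem lintegral_norm_act {n q : ℕ} (x : EuclideanSpace ℝ (Fin (q + 1))) {f : ℝ → ENNReal}
    (hf : Measurable f) :
    ∫⁻ G, f (‖act G x‖ ^ 2) ∂gauss (Fin n × Fin (q + 1)) =
      ∫⁻ h, f (‖x‖ ^ 2 * len h ^ 2) ∂gauss (Fin n) := by
  obtain ⟨R, hR, -, hx⟩ := exists_orthogonal_mulVec (x : Fin (q + 1) → ℝ)
  have hm : Measurable fun G : Fin n × Fin (q + 1) → ℝ => f (‖act G x‖ ^ 2) := by
    simp only [norm_act_sq]
    fun_prop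
  have hlen : len (x : Fin (q + 1) → ℝ) = ‖x‖ := by rw [len_eq_norm]
  have key : ∀ (h : Fin n → ℝ) (G : Fin n × Fin q → ℝ),
      ‖act (mulRight R.transpose (Sum.elim h G ∘ splitCol n q)) x‖ ^ 2 = ‖x‖ ^ 2 * len h ^ 2 := by
    intro h G
    rw [norm_act_sq, len_sq, Finset.mul_sum]
    refine Finset.sum_congr rfl fun i _ => ?_
    rw [← mul_pow, sum_mulRight_mul hR hx, hlen]
  rw [lintegral_gauss_mulRight hR hm]
  simp only [key]
  simp

theorem measureReal_mul_le_of_ball {Ω E : Type*} [MeasurableSpace Ω] (μ : Measure Ω)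
    [IsFiniteMeasure μ] [NormedAddCommGroup E] [NormedSpace ℝ E] [FiniteDimensional ℝ E]
    [MeasurableSpace E] [BorelSpace E] {S : Set E} (hS : MeasurableSet S) {ρ η : ℝ} (hη : 0 < η)
    (hρ : 0 < ρ) (hSρ : S ⊆ Metric.ball 0 ρ) {F : Ω → E → ℝ}
    (hF : Measurable (Function.uncurry F)) {L U : ℝ} (hL0 : 0 ≤ L) (hU0 : 0 ≤ U)
    (hU : ∀ x ∈ S, ∫⁻ ω, ENNReal.ofReal (F ω x) ∂μ ≤ ENNReal.ofReal U) {bad : Set Ω}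
    (hbad : ∀ ω ∈ bad, ∃ c, Metric.ball c η ⊆ S ∧ ∀ x ∈ Metric.ball c η, L ≤ F ω x) :
    η ^ Module.finrank ℝ E * L * μ.real bad ≤ ρ ^ Module.finrank ℝ E * U := by
  have h := measure_mul_le_of_ball μ hS hη hρ hSρ (F := fun ω x => ENNReal.ofReal (F ω x))
    (L := ENNReal.ofReal L) (U := ENNReal.ofReal U) hF.ennreal_ofReal hU
    (bad := bad) fun ω hω => by
      obtain ⟨c, hc, hL⟩ := hbad ω hω
      exact ⟨c, hc, fun x hx => ENNReal.ofReal_le_ofReal (hL x hx)⟩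
  rw [← ofReal_measureReal (measure_ne_top μ bad), ← ENNReal.ofReal_mul (by positivity),
    ← ENNReal.ofReal_mul (by positivity), ← ENNReal.ofReal_mul (by positivity)] at h
  exact (ENNReal.ofReal_le_ofReal_iff (by positivity)).1 h

/-- The vector Gx is |x| times a standard Gaussian vector, so this is the Laplace transform of |h|².
The number b bounds a|x|² below uniformly over the region of x, for either sign of a. -/
theorem lintegral_exp_norm_act_le {n q : ℕ} (x : EuclideanSpace ℝ (Fin (q + 1))) {a b c : ℝ}
    (hb : -1 / 2 < b) (hab : b ≤ a * ‖x‖ ^ 2) (hc : Real.sqrt (1 / (1 + 2 * b)) ≤ c) :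
    ∫⁻ G, ENNReal.ofReal (Real.exp (-a * ‖act G x‖ ^ 2)) ∂gauss (Fin n × Fin (q + 1)) ≤
      ENNReal.ofReal (c ^ n) := by
  rw [lintegral_norm_act x (f := fun t => ENNReal.ofReal (Real.exp (-a * t))) (by fun_prop),
    ENNReal.ofReal_pow ((Real.sqrt_nonneg _).trans hc)]
  calc _ ≤ ∫⁻ h, ENNReal.ofReal (Real.exp (-b * len h ^ 2)) ∂gauss (Fin n) := by
        refine lintegral_mono fun h => ?_
        gcongr ENNReal.ofReal (Real.exp ?_)
        nlinarith [sq_nonneg (len h)]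
    _ = ENNReal.ofReal (Real.sqrt (1 / (1 + 2 * b))) ^ n := lintegral_exp_neg_mul_len_sq n hb
    _ ≤ _ := by gcongr

theorem measurable_exp_norm_act {n q : ℕ} (a : ℝ) : Measurable (Function.uncurry
    fun (G : Fin n × Fin q → ℝ) (x : EuclideanSpace ℝ (Fin q)) =>
      Real.exp (-a * ‖act G x‖ ^ 2)) := by
  have := measurable_norm_act (n := n) (q := q)
  simp only [Function.uncurry_def]
  fun_prop

/-- A Gaussian matrix has operator norm at most `8 √n` with overwhelming probability. -/
theorem measureReal_norm_act_gt_le {n q : ℕ} (hn : 9 * (q + 1) ≤ n) :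
    (gauss (Fin n × Fin (q + 1))).real
      {G | ∃ x, 8 * Real.sqrt n * ‖x‖ < ‖act G x‖} ≤ (1 / 2) ^ n := by
  -- If a unit vector u attains the maximum M ≥ 8√n, then |Gx| ≥ 3M/4 − M/4 ≥ 4√n on the ball of
  -- radius 1/4 about 3u/4. There exp(|Gx|²/4) ≥ exp(4n), while its mean is at most 2ⁿ for |x| < 1.
  have h := measureReal_mul_le_of_ball (gauss (Fin n × Fin (q + 1)))
    (S := Metric.ball (0 : EuclideanSpace ℝ (Fin (q + 1))) 1) measurableSet_ball
    (ρ := 1) (η := 1 / 4) (by norm_num) one_pos subset_rfl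
    (F := fun G x => Real.exp (-(-1 / 4) * ‖act G x‖ ^ 2)) (measurable_exp_norm_act _)
    (L := Real.exp (4 * n)) (U := 2 ^ n) (by positivity) (by positivity)
    (fun x hx => lintegral_exp_norm_act_le x (b := -1 / 4) (by norm_num) (by
      have : ‖x‖ < 1 := by simpa using hx
      nlinarith [norm_nonneg x]) (by
        rw [Real.sqrt_le_left (by norm_num)]; norm_num))
    (bad := {G | ∃ x, 8 * Real.sqrt n * ‖x‖ < ‖act G x‖}) (by
      rintro G ⟨y, hy⟩
      have hcont : Continuous fun x => ‖act G x‖ :=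
        (LinearMap.continuous_of_finiteDimensional (act G)).norm
      obtain ⟨u, hu, hmax⟩ := (isCompact_sphere (0 : EuclideanSpace ℝ (Fin (q + 1))) 1).exists_isMaxOn
        ⟨EuclideanSpace.single 0 1, by simp⟩ hcont.continuousOn
      have hu1 : ‖u‖ = 1 := by simpa using hu
      set M := ‖act G u‖ with hM
      have hmax' : ∀ x, ‖act G x‖ ≤ M * ‖x‖ := fun x => by
        rcases eq_or_ne x 0 with rfl | hx
        · simp
        have hx' : 0 < ‖x‖ := norm_pos_iff.2 hx
        have h1 : ‖act G (‖x‖⁻¹ • x)‖ ≤ M := hmax (by simp [norm_smul, hx])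
        rw [map_smul, norm_smul, norm_inv, norm_norm, inv_mul_le_iff₀ hx'] at h1
        linarith
      have hM8 : 8 * Real.sqrt n ≤ M := by
        have h1 := hy.trans_le (hmax' y)
        by_contra! h2
        nlinarith [norm_nonneg y]
      refine ⟨(3 / 4 : ℝ) • u, fun x hx => ?_, fun x hx => ?_⟩
      · have h1 : ‖x - (3 / 4 : ℝ) • u‖ < 1 / 4 := by simpa [dist_eq_norm] using hx
        have h2 : ‖x‖ ≤ ‖x - (3 / 4 : ℝ) • u‖ + ‖(3 / 4 : ℝ) • u‖ := by
          simpa using norm_add_le (x - (3 / 4 : ℝ) • u) ((3 / 4 : ℝ) • u)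
        rw [norm_smul, hu1] at h2
        norm_num at h2
        simpa using (by linarith : ‖x‖ < 1)
      · have h1 : ‖x - (3 / 4 : ℝ) • u‖ < 1 / 4 := by simpa [dist_eq_norm] using hx
        have h2 : ‖act G ((3 / 4 : ℝ) • u)‖ ≤ ‖act G x‖ + ‖act G (x - (3 / 4 : ℝ) • u)‖ := by
          have := norm_sub_le (act G x) (act G (x - (3 / 4 : ℝ) • u))
          rwa [← map_sub, sub_sub_cancel] at this
        rw [map_smul, norm_smul, Real.norm_of_nonneg (by norm_num), ← hM] at h2
        have h3 := hmax' (x - (3 / 4 : ℝ) • u)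
        have hs := Real.sqrt_nonneg (n : ℝ)
        have h4 : 4 * Real.sqrt n ≤ ‖act G x‖ := by nlinarith
        have h5 := pow_le_pow_left₀ (by positivity) h4 2
        rw [mul_pow, Real.sq_sqrt (Nat.cast_nonneg (α := ℝ) n)] at h5
        exact Real.exp_le_exp.2 (by linarith))
  rw [finrank_euclideanSpace, Fintype.card_fin, one_pow, one_mul] at h
  set p := (gauss (Fin n × Fin (q + 1))).real {G | ∃ x, 8 * Real.sqrt n * ‖x‖ < ‖act G x‖}
  have hp : 0 ≤ p := measureReal_nonneg
  have he : (16 : ℝ) ^ n ≤ Real.exp (4 * n) := by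
    rw [mul_comm, Real.exp_nat_mul]
    gcongr
    rw [show (4 : ℝ) = (4 : ℕ) * 1 by norm_num, Real.exp_nat_mul]
    calc (16 : ℝ) = 2 ^ 4 := by norm_num
      _ ≤ _ := by gcongr; linarith [Real.add_one_le_exp (1 : ℝ)]
  have hq : (4 : ℝ) ^ (q + 1) ≤ 2 ^ n := by
    rw [show (4 : ℝ) = 2 ^ 2 by norm_num, ← pow_mul]
    exact pow_le_pow_right₀ (by norm_num) (by omega)
  have h1 : 16 ^ n * p ≤ (4 : ℝ) ^ (q + 1) * 2 ^ n := by
    calc (16 : ℝ) ^ n * p ≤ Real.exp (4 * n) * p := by gcongr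
      _ = 4 ^ (q + 1) * ((1 / 4) ^ (q + 1) * Real.exp (4 * n) * p) := by
        rw [one_div, inv_pow]; field_simp
      _ ≤ _ := by gcongr
  have h2 : (16 : ℝ) ^ n * p ≤ 2 ^ n * 2 ^ n := h1.trans (by gcongr)
  have h3 : (16 : ℝ) ^ n = 2 ^ n * 2 ^ n * (2 ^ n * 2 ^ n) := by
    rw [← mul_pow, ← mul_pow]; norm_num
  rw [one_div, inv_pow, ← one_div, le_div_iff₀ (by positivity)]
  have h4 : (1 : ℝ) ≤ 2 ^ n := one_le_pow₀ (by norm_num)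
  have h5 : (0 : ℝ) < 2 ^ n * 2 ^ n := by positivity
  have h6 : 2 ^ n * 2 ^ n * p ≤ (1 : ℝ) := by
    rw [h3, mul_assoc] at h2
    exact le_of_mul_le_mul_left (by linarith) h5
  nlinarith [mul_nonneg hp (by positivity : (0 : ℝ) ≤ 2 ^ n)]

/-- A tall Gaussian matrix has least singular value at least `√n / 32` with overwhelming
probability. -/
theorem measureReal_norm_act_lt_le {n q : ℕ} (hn : 9 * (q + 1) ≤ n) :
    (gauss (Fin n × Fin (q + 1))).real {G | (∀ x, ‖act G x‖ ≤ 8 * Real.sqrt n * ‖x‖) ∧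
      ∃ x, ‖act G x‖ < Real.sqrt n / 32 * ‖x‖} ≤ (1 / 2) ^ n := by
  -- If |Gu| ≤ √n/32 for a unit vector u, the upper bound 8√n gives |Gx| ≤ √n/16 within 1/256 of u,
  -- hence exp(−128|Gx|²) ≥ exp(−n/2). For |x| ≥ 1/2 the mean is at most 65^(−n/2) ≤ 8⁻ⁿ.
  have h := measureReal_mul_le_of_ball (gauss (Fin n × Fin (q + 1)))
    (S := Metric.ball (0 : EuclideanSpace ℝ (Fin (q + 1))) 2 ∩ {x | 1 / 2 ≤ ‖x‖})
    (measurableSet_ball.inter (measurableSet_le measurable_const measurable_norm))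
    (ρ := 2) (η := 1 / 256) (by norm_num) two_pos Set.inter_subset_left
    (F := fun G x => Real.exp (-128 * ‖act G x‖ ^ 2)) (measurable_exp_norm_act _)
    (L := Real.exp (-(n / 2))) (U := (1 / 8) ^ n) (by positivity) (by positivity)
    (fun x hx => lintegral_exp_norm_act_le x (b := 32) (by norm_num) (by
      have : 1 / 2 ≤ ‖x‖ := hx.2
      nlinarith) (by
        rw [Real.sqrt_le_left (by norm_num)]; norm_num))
    (bad := {G | (∀ x, ‖act G x‖ ≤ 8 * Real.sqrt n * ‖x‖) ∧
      ∃ x, ‖act G x‖ < Real.sqrt n / 32 * ‖x‖}) (by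
      rintro G ⟨hG, y, hy⟩
      have hs := Real.sqrt_nonneg (n : ℝ)
      have hy0 : 0 < ‖y‖ := by
        by_contra! h0
        nlinarith [norm_nonneg (act G y), norm_nonneg y]
      set u := ‖y‖⁻¹ • y with hu
      have hu1 : ‖u‖ = 1 := by
        rw [hu, norm_smul, norm_inv, norm_norm, inv_mul_cancel₀ hy0.ne']
      have hGu : ‖act G u‖ ≤ Real.sqrt n / 32 := by
        rw [hu, map_smul, norm_smul, norm_inv, norm_norm, inv_mul_le_iff₀ hy0]
        linarith
      refine ⟨u, fun x hx => ?_, fun x hx => ?_⟩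
      · have h1 : ‖x - u‖ < 1 / 256 := by simpa [dist_eq_norm] using hx
        have h2 := abs_le.1 (abs_norm_sub_norm_le x u)
        rw [hu1] at h2
        exact ⟨by simpa using (by linarith : ‖x‖ < 2), by
          change 1 / 2 ≤ ‖x‖
          linarith⟩
      · have h1 : ‖x - u‖ < 1 / 256 := by simpa [dist_eq_norm] using hx
        have h2 : ‖act G x‖ ≤ ‖act G (x - u)‖ + ‖act G u‖ := by
          have := norm_add_le (act G (x - u)) (act G u)
          rwa [← map_add, sub_add_cancel] at this
        have h3 := hG (x - u)
        have h4 : ‖act G x‖ ≤ Real.sqrt n / 16 := by nlinarith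
        have h5 := Real.sq_sqrt (Nat.cast_nonneg (α := ℝ) n)
        gcongr
        nlinarith [norm_nonneg (act G x)])
  rw [finrank_euclideanSpace, Fintype.card_fin] at h
  set p := (gauss (Fin n × Fin (q + 1))).real {G | (∀ x, ‖act G x‖ ≤ 8 * Real.sqrt n * ‖x‖) ∧
      ∃ x, ‖act G x‖ < Real.sqrt n / 32 * ‖x‖}
  have hp : 0 ≤ p := measureReal_nonneg
  have he : Real.exp (n / 2) ≤ 2 ^ n := by
    rw [div_eq_mul_one_div, Real.exp_nat_mul]
    gcongr
    have h1 : Real.exp (1 / 2) ^ 2 = Real.exp 1 := by rw [← Real.exp_nat_mul]; norm_num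
    nlinarith [Real.exp_one_lt_d9, Real.exp_pos (1 / 2 : ℝ)]
  -- The ratio of the radii 2 and 1/256 is 512 = 2⁹, which is the source of the aspect ratio 9.
  have hq : (512 : ℝ) ^ (q + 1) ≤ 2 ^ n := by
    rw [show (512 : ℝ) = 2 ^ 9 by norm_num, ← pow_mul]
    exact pow_le_pow_right₀ (by norm_num) hn
  have h512 : (256 : ℝ) ^ (q + 1) * 2 ^ (q + 1) = 512 ^ (q + 1) := by
    rw [← mul_pow]; norm_num
  calc p = 256 ^ (q + 1) * Real.exp (n / 2) *
        ((1 / 256) ^ (q + 1) * Real.exp (-(n / 2)) * p) := by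
        rw [one_div, inv_pow, Real.exp_neg]; field_simp
    _ ≤ 256 ^ (q + 1) * Real.exp (n / 2) * (2 ^ (q + 1) * (1 / 8) ^ n) := by gcongr
    _ = 512 ^ (q + 1) * Real.exp (n / 2) * (1 / 8) ^ n := by rw [← h512]; ring
    _ ≤ 2 ^ n * 2 ^ n * (1 / 8) ^ n := by gcongr
    _ = (1 / 2) ^ n := by rw [← mul_pow, ← mul_pow]; norm_num

/-- The matrices with all singular values between `√n / 32` and `8 √n`. -/
def wellConditioned (n q : ℕ) : Set (Fin n × Fin q → ℝ) :=
  {G | ∀ x, Real.sqrt n / 32 * ‖x‖ ≤ ‖act G x‖ ∧ ‖act G x‖ ≤ 8 * Real.sqrt n * ‖x‖}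

theorem measureReal_compl_wellConditioned_le {n q : ℕ} (hq : 0 < q) (hn : 9 * q ≤ n) :
    (gauss (Fin n × Fin q)).real (wellConditioned n q)ᶜ ≤ 2 * (1 / 2) ^ n := by
  obtain ⟨p, rfl⟩ : ∃ p, q = p + 1 := ⟨q - 1, by omega⟩
  calc _ ≤ (gauss (Fin n × Fin (p + 1))).real ({G | ∃ x, 8 * Real.sqrt n * ‖x‖ < ‖act G x‖} ∪
        {G | (∀ x, ‖act G x‖ ≤ 8 * Real.sqrt n * ‖x‖) ∧
          ∃ x, ‖act G x‖ < Real.sqrt n / 32 * ‖x‖}) := by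
        refine measureReal_mono (fun G hG => ?_)
        by_cases h : ∃ x, 8 * Real.sqrt n * ‖x‖ < ‖act G x‖
        · exact Or.inl h
        · push Not at h
          refine Or.inr ⟨h, ?_⟩
          by_contra! h'
          exact hG fun x => ⟨h' x, h x⟩
    _ ≤ _ := measureReal_union_le _ _
    _ ≤ (1 / 2) ^ n + (1 / 2) ^ n :=
      add_le_add (measureReal_norm_act_gt_le hn) (measureReal_norm_act_lt_le hn)
    _ = _ := by ring

/-! ### Spectrum and Frobenius norm of Gram matrices -/

theorem posSemidef_gram {n q : ℕ} (G : Fin n × Fin q → ℝ) :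
    (Matrix.of (gram G)).PosSemidef := by
  rw [of_gram]
  exact Matrix.posSemidef_self_mul_conjTranspose (Matrix.of fun i j => G (i, j))

theorem sortedEigenvalues_antitone {n : ℕ} {A : Matrix (Fin n) (Fin n) ℝ} (hA : A.IsHermitian) :
    Antitone (sortedEigenvalues hA) := fun _ _ hij => hA.eigenvalues₀_antitone hij

theorem exists_sortedEigenvalues_eq {n : ℕ} {A : Matrix (Fin n) (Fin n) ℝ} (hA : A.IsHermitian) :
    ∃ e : Fin n ≃ Fin n, ∀ i, sortedEigenvalues hA i = hA.eigenvalues (e i) :=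
  ⟨(finCongr (Fintype.card_fin n).symm).trans (Fintype.equivOfCardEq (Fintype.card_fin _)),
    fun i => by simp [sortedEigenvalues, Matrix.IsHermitian.eigenvalues]⟩

/-- The eigenvalues are nonnegative and non-increasing, so the nonzero ones form an initial segment,
whose length is the rank. -/
theorem sortedEigenvalues_ne_zero_iff {n : ℕ} {A : Matrix (Fin n) (Fin n) ℝ} (hA : A.PosSemidef)
    (r : Fin n) : sortedEigenvalues hA.isHermitian r ≠ 0 ↔ (r : ℕ) < A.rank := by
  obtain ⟨e, he⟩ := exists_sortedEigenvalues_eq hA.isHermitian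
  have hnn : ∀ i, 0 ≤ sortedEigenvalues hA.isHermitian i := fun i => by
    rw [he]; exact hA.eigenvalues_nonneg _
  have hrank : A.rank =
      (Finset.univ.filter fun i => sortedEigenvalues hA.isHermitian i ≠ 0).card := by
    rw [hA.isHermitian.rank_eq_card_non_zero_eigs, Fintype.card_subtype]
    refine (Finset.card_equiv e fun i => ?_).symm
    simp [he]
  rw [hrank]
  constructor
  · intro h
    have h1 : Finset.Iic r ⊆
        Finset.univ.filter fun i => sortedEigenvalues hA.isHermitian i ≠ 0 := fun i hi => by
      have := sortedEigenvalues_antitone hA.isHermitian (Finset.mem_Iic.1 hi)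
      simpa using (((hnn r).lt_of_ne' h).trans_le this).ne'
    have := Finset.card_le_card h1
    rw [Fin.card_Iic] at this
    omega
  · intro h h0
    have h1 : (Finset.univ.filter fun i => sortedEigenvalues hA.isHermitian i ≠ 0) ⊆
        Finset.Iio r := fun i hi => by
      rw [Finset.mem_Iio]
      by_contra! hri
      have := sortedEigenvalues_antitone hA.isHermitian hri
      exact (Finset.mem_filter.1 hi).2 (le_antisymm (this.trans h0.le) (hnn i))
    have := Finset.card_le_card h1
    rw [Fin.card_Iio] at this
    omega

/-- A Gram matrix of vectors in dimension `q` has at most `q` nonzero eigenvalues. -/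
theorem sortedEigenvalues_gram_eq_zero {n q : ℕ} (G : Fin n × Fin q → ℝ) {r : Fin n}
    (hr : q ≤ r) : sortedEigenvalues (posSemidef_gram G).isHermitian r = 0 := by
  by_contra h
  have h1 := (sortedEigenvalues_ne_zero_iff (posSemidef_gram G) r).1 h
  have h2 : (Matrix.of (gram G)).rank ≤ q := by
    rw [of_gram]
    exact (Matrix.rank_mul_le_left _ _).trans
      (Matrix.rank_le_width (Matrix.of fun i j => G (i, j)))
  exact absurd (h1.trans_le h2) (not_lt.2 hr)

theorem act_eq {n q : ℕ} (G : Fin n × Fin q → ℝ) (x : EuclideanSpace ℝ (Fin q)) :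
    act G x = WithLp.toLp 2 ((Matrix.of fun i j => G (i, j)).mulVec x) := rfl

theorem norm_toLp_sq {ι : Type*} [Fintype ι] (x : ι → ℝ) :
    ‖WithLp.toLp 2 x‖ ^ 2 = x ⬝ᵥ x := by
  rw [EuclideanSpace.norm_sq_eq]
  simp [dotProduct, sq]

/-- If `|G x| ≥ σ |x|` for all `x` in dimension `q`, then `G Gᵀ` has `q` eigenvalues that are at
least `σ²`. -/
theorem le_sortedEigenvalues_gram {n q : ℕ} (G : Fin n × Fin q → ℝ) {σ : ℝ} (hσ : 0 < σ)
    (hG : ∀ x, σ * ‖x‖ ≤ ‖act G x‖) {r : Fin n} (hr : (r : ℕ) < q) :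
    σ ^ 2 ≤ sortedEigenvalues (posSemidef_gram G).isHermitian r := by
  set M : Matrix (Fin n) (Fin q) ℝ := Matrix.of fun i j => G (i, j) with hM
  have hrank : (Matrix.of (gram G)).rank = q := by
    rw [of_gram, Matrix.rank_self_mul_transpose]
    have hinj : Function.Injective M.mulVecLin := by
      rw [injective_iff_map_eq_zero]
      intro x hx
      have h1 := hG (WithLp.toLp 2 x)
      rw [act_eq] at h1
      have h2 : M.mulVec x = 0 := hx
      rw [← hM, h2] at h1
      have h3 : ‖WithLp.toLp 2 x‖ ≤ 0 := by
        by_contra! h0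
        have := mul_pos hσ h0
        simp at h1
        linarith
      simpa using h3
    rw [Matrix.rank, LinearMap.finrank_range_of_inj hinj]
    simp
  have hne := (sortedEigenvalues_ne_zero_iff (posSemidef_gram G) r).2 (hr.trans_eq hrank.symm)
  obtain ⟨e, he⟩ := exists_sortedEigenvalues_eq (posSemidef_gram G).isHermitian
  rw [he] at hne ⊢
  set l := (posSemidef_gram G).isHermitian.eigenvalues (e r)
  have hl : 0 < l := ((posSemidef_gram G).eigenvalues_nonneg _).lt_of_ne' hne
  set v := (posSemidef_gram G).isHermitian.eigenvectorBasis (e r) with hv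
  have hv1 : ‖v‖ = 1 := (posSemidef_gram G).isHermitian.eigenvectorBasis.orthonormal.1 _
  have hAv : (Matrix.of (gram G)).mulVec v = l • (v : Fin n → ℝ) :=
    (posSemidef_gram G).isHermitian.mulVec_eigenvectorBasis (e r)
  rw [of_gram, ← hM, ← Matrix.mulVec_mulVec] at hAv
  -- For a unit eigenvector v with eigenvalue l > 0, y = Mᵀv satisfies |y|² = l and My = lv. Thus
  -- σ²l ≤ l², and no minimax principle is needed.
  set y := M.transpose.mulVec v with hy
  have hvv : (v : Fin n → ℝ) ⬝ᵥ (v : Fin n → ℝ) = 1 := by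
    rw [← norm_toLp_sq]
    change ‖v‖ ^ 2 = 1
    rw [hv1, one_pow]
  have hyy : y ⬝ᵥ y = l := by
    conv_lhs => rw [hy, Matrix.mulVec_transpose, ← Matrix.dotProduct_mulVec]
    rw [← Matrix.mulVec_transpose, ← hy, hAv, dotProduct_smul, hvv]
    simp
  have h1 := pow_le_pow_left₀ (by positivity) (hG (WithLp.toLp 2 y)) 2
  rw [mul_pow, norm_toLp_sq, hyy, act_eq, ← hM] at h1
  change σ ^ 2 * l ≤ ‖WithLp.toLp 2 (M.mulVec y)‖ ^ 2 at h1
  rw [hAv, norm_toLp_sq, smul_dotProduct, dotProduct_smul, hvv] at h1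
  simp only [smul_eq_mul, mul_one] at h1
  exact le_of_mul_le_mul_right h1 hl

theorem frobeniusNorm_sq {n : ℕ} (A : Matrix (Fin n) (Fin n) ℝ) :
    frobeniusNorm A ^ 2 = ∑ i, ∑ j, A i j ^ 2 := by
  rw [frobeniusNorm, Matrix.frobenius_norm_def, ← Real.rpow_natCast, ← Real.rpow_mul (by positivity)]
  norm_num

theorem frobeniusNorm_nonneg {n : ℕ} (A : Matrix (Fin n) (Fin n) ℝ) : 0 ≤ frobeniusNorm A := by
  rw [frobeniusNorm, Matrix.frobenius_norm_def]
  positivity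

/-- Each row of GGᵀ is G applied to a row of G, so ‖GGᵀ‖_F ≤ K‖G‖_F; each of the q columns of G has
length at most K. -/
theorem frobeniusNorm_gram_le {n q : ℕ} (G : Fin n × Fin q → ℝ) {K : ℝ}
    (hG : ∀ x, ‖act G x‖ ≤ K * ‖x‖) :
    frobeniusNorm (Matrix.of (gram G)) ≤ K ^ 2 * Real.sqrt q := by
  have hcol : ∀ j, ∑ i, G (i, j) ^ 2 ≤ K ^ 2 := fun j => by
    have := pow_le_pow_left₀ (norm_nonneg _) (hG (EuclideanSpace.single j 1)) 2
    rw [norm_act_sq, mul_pow] at this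
    simpa using this
  have hrow : ∀ i', ∑ i, gram G i i' ^ 2 ≤ K ^ 2 * ∑ j, G (i', j) ^ 2 := fun i' => by
    have := pow_le_pow_left₀ (norm_nonneg _) (hG (WithLp.toLp 2 fun j => G (i', j))) 2
    rw [norm_act_sq, mul_pow, norm_toLp_sq] at this
    simpa [gram, dotProduct, sq] using this
  refine abs_le_of_sq_le_sq' ?_ (by positivity) |>.2
  rw [frobeniusNorm_sq, mul_pow, Real.sq_sqrt (Nat.cast_nonneg q), Finset.sum_comm]
  calc ∑ i', ∑ i, gram G i i' ^ 2 ≤ ∑ i', K ^ 2 * ∑ j, G (i', j) ^ 2 :=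
        Finset.sum_le_sum fun i' _ => hrow i'
    _ = K ^ 2 * ∑ j, ∑ i', G (i', j) ^ 2 := by rw [← Finset.mul_sum, Finset.sum_comm]
    _ ≤ K ^ 2 * ∑ j : Fin q, K ^ 2 := by gcongr with j; exact hcol j
    _ = _ := by simp; ring

/-! ### The query lower bound -/

section LowerBound

variable {Ω : Type*} [MeasurableSpace Ω] {P : Measure Ω} [IsProbabilityMeasure P] {n k : ℕ}

theorem measurableSet_success (alg : MatVecAlgorithm Ω n k) (A : Fin n → Fin n → ℝ)
    (b : Fin n → ℝ) (c : ℝ) :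
    MeasurableSet {ω | ∀ i, |alg.run (Matrix.of A) ω i - b i| ≤ c} := by
  have h : Measurable fun ω => alg.run (Matrix.of A) ω :=
    alg.measurable_run.comp measurable_prodMk_left
  rw [Set.ofPred_forall]
  refine MeasurableSet.iInter fun i => measurableSet_le ?_ measurable_const
  have h2 : Measurable fun ω => alg.run (Matrix.of A) ω i := (measurable_pi_apply i).comp h
  exact (h2.sub_const _).abs

/-- At least one query is needed. -/
theorem EstimatesEigenvalues.queries_pos {ε : ℝ} (hε : ε < 1) (hn : 0 < n)
    {alg : MatVecAlgorithm Ω n k} (h : EstimatesEigenvalues P alg ε) : 0 < k := by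
  rcases Nat.eq_zero_or_pos k with rfl | hk
  swap
  · exact hk
  exfalso
  let i0 : Fin n := ⟨0, hn⟩
  -- The Gram matrix is a coordinate projection, with top eigenvalue 1 and Frobenius norm at most 1.
  -- The zero matrix allows no error, so its output is exactly 0, which misses 1 by more than ε.
  let G : Fin n × Fin 1 → ℝ := fun p => if p.1 = i0 then 1 else 0
  have hA := posSemidef_gram G
  have h0 := posSemidef_gram (0 : Fin n × Fin 1 → ℝ)
  have hnorm : ∀ x, ‖act G x‖ = 1 * ‖x‖ := fun x => by
    have : ‖act G x‖ ^ 2 = ‖x‖ ^ 2 := by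
      rw [norm_act_sq, EuclideanSpace.norm_sq_eq]
      simp [G]
    rw [one_mul]
    exact (sq_eq_sq₀ (norm_nonneg _) (norm_nonneg _)).1 this
  have hl : 1 ≤ sortedEigenvalues hA.isHermitian i0 := by
    simpa using le_sortedEigenvalues_gram G one_pos (fun x => (hnorm x).ge) (r := i0) zero_lt_one
  have hf : frobeniusNorm (Matrix.of (gram G)) ≤ 1 := by
    simpa using frobeniusNorm_gram_le G (fun x => (hnorm x).le)
  have hz : Matrix.of (gram (0 : Fin n × Fin 1 → ℝ)) = 0 := by
    ext i j; simp [gram]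
  have hf0 : frobeniusNorm (Matrix.of (gram (0 : Fin n × Fin 1 → ℝ))) = 0 := by
    rw [← sq_eq_zero_iff, frobeniusNorm_sq, hz]; simp
  have hl0 : sortedEigenvalues h0.isHermitian i0 = 0 := by
    by_contra hne
    have := (sortedEigenvalues_ne_zero_iff h0 i0).1 hne
    rw [hz, Matrix.rank_zero] at this
    omega
  have p1 := h _ hA.isHermitian
  have p2 := h _ h0.isHermitian
  obtain ⟨ω, h1, h2⟩ := nonempty_inter_of_measureReal_lt_add (μ := P)
    (measurableSet_success alg (gram (0 : Fin n × Fin 1 → ℝ))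
      (sortedEigenvalues h0.isHermitian) _) (Set.subset_univ _) (Set.subset_univ _)
    (lt_of_lt_of_le (b := 3 / 4 + 3 / 4) (by rw [probReal_univ]; norm_num) (add_le_add p1 p2))
  have e1 := h1 i0
  have e2 := h2 i0
  rw [hf0, hl0] at e2
  have e3 : alg.run (Matrix.of (gram G)) ω i0 =
    alg.run (Matrix.of (gram (0 : Fin n × Fin 1 → ℝ))) ω i0 := rfl
  rw [e3] at e1
  have := abs_le.1 e1
  have := abs_le.1 e2
  rcases le_or_gt 0 ε with h | h <;> nlinarith [frobeniusNorm_nonneg (Matrix.of (gram G))]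

/-- The probability that the `r`-th output of the algorithm exceeds `τ` on a random Gram matrix. -/
noncomputable def exceedProb (P : Measure Ω) (alg : MatVecAlgorithm Ω n k) (r : Fin n) (τ : ℝ)
    (q : ℕ) : ENNReal :=
  ∫⁻ G, P {ω | τ < alg.run (Matrix.of (gram G)) ω r} ∂gauss (Fin n × Fin q)

theorem measurableSet_exceed (alg : MatVecAlgorithm Ω n k) (r : Fin n) (τ : ℝ) :
    MeasurableSet {p : (Fin n → Fin n → ℝ) × Ω | τ < alg.run (Matrix.of p.1) p.2 r} :=
  measurableSet_lt measurable_const ((measurable_pi_apply r).comp alg.measurable_run)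

/-- With the randomness outermost, the integrand for each ω is a deterministic adaptive function. -/
theorem exceedProb_eq (alg : MatVecAlgorithm Ω n k) (r : Fin n) (τ : ℝ) (q : ℕ) :
    exceedProb P alg r τ q = ∫⁻ ω, ∫⁻ G, {A : Fin n → Fin n → ℝ |
      τ < alg.run (Matrix.of A) ω r}.indicator 1 (gram G) ∂gauss (Fin n × Fin q) ∂P := by
  have hm : Measurable (Function.uncurry fun (ω : Ω) (G : Fin n × Fin q → ℝ) =>
      {A : Fin n → Fin n → ℝ | τ < alg.run (Matrix.of A) ω r}.indicator
        (1 : (Fin n → Fin n → ℝ) → ENNReal) (gram G)) :=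
    (measurable_one.indicator (measurableSet_exceed alg r τ)).comp
      ((measurable_gram.comp measurable_snd).prodMk measurable_fst)
  rw [lintegral_lintegral_swap hm.aemeasurable, exceedProb]
  refine lintegral_congr fun G => ?_
  have hs : MeasurableSet {ω | τ < alg.run (Matrix.of (gram G)) ω r} :=
    measurable_prodMk_left (measurableSet_exceed alg r τ)
  rw [← lintegral_indicator_one hs]
  rfl

theorem exceedProb_le_one (alg : MatVecAlgorithm Ω n k) (r : Fin n) (τ : ℝ) (q : ℕ) :
    exceedProb P alg r τ q ≤ 1 := by
  calc exceedProb P alg r τ q ≤ ∫⁻ G, 1 ∂gauss (Fin n × Fin q) :=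
        lintegral_mono fun G => prob_le_one
    _ = 1 := by simp

/-- Few queries cannot distinguish Gram matrices of vectors in dimensions `s + k` and
`s + k + 2`. -/
theorem sq_exceedProb_le {m : ℕ} (alg : MatVecAlgorithm Ω (m + k) k) (r : Fin (m + k)) (τ : ℝ)
    (s : ℕ) : ((s + 2) * (s + 1) : ℕ) * exceedProb P alg r τ (s + k + 2) ^ 2 ≤
      ((s + k + 2) * (s + k + 1) : ℕ) * exceedProb P alg r τ (s + k) := by
  rw [exceedProb_eq, exceedProb_eq]
  have hms : ∀ ω, MeasurableSet {A : Fin (m + k) → Fin (m + k) → ℝ |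
      τ < alg.run (Matrix.of A) ω r} := fun ω =>
    measurable_prodMk_right (measurableSet_exceed alg r τ)
  have hm : ∀ q, Measurable fun p : Ω × (Fin (m + k) × Fin q → ℝ) =>
      {A : Fin (m + k) → Fin (m + k) → ℝ | τ < alg.run (Matrix.of A) p.1 r}.indicator
        (1 : (Fin (m + k) → Fin (m + k) → ℝ) → ENNReal) (gram p.2) := fun q =>
    (measurable_one.indicator (measurableSet_exceed alg r τ)).comp
      ((measurable_gram.comp measurable_snd).prodMk measurable_fst)
  -- Jensen over the internal randomness reduces the bound to fixed ω; an indicator equals its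
  -- square.
  refine (mul_le_mul_right (lintegral_sq_le P
    (hm (s + k + 2)).lintegral_prod_right'.aemeasurable) _).trans ?_
  rw [← lintegral_const_mul' _ _ (ENNReal.natCast_ne_top _),
    ← lintegral_const_mul' _ _ (ENNReal.natCast_ne_top _)]
  refine lintegral_mono fun ω => ?_
  have ha : AdaptiveOn k Set.univ ({A : Fin (m + k) → Fin (m + k) → ℝ |
      τ < alg.run (Matrix.of A) ω r}.indicator (1 : (Fin (m + k) → Fin (m + k) → ℝ) → ENNReal)) :=
    (alg.adaptiveOn_run ω).comp_right ({y : Fin (m + k) → ℝ | τ < y r}.indicator 1)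
  refine (sq_lintegral_gram_le k s m (measurable_one.indicator (hms ω)) ha).trans_eq ?_
  congr 2
  funext G
  by_cases h : gram G ∈ {A : Fin (m + k) → Fin (m + k) → ℝ | τ < alg.run (Matrix.of A) ω r} <;>
    simp [h]

theorem le_exceedProb {q : ℕ} (alg : MatVecAlgorithm Ω n k) (r : Fin n) (τ : ℝ)
    {W : Set (Fin n × Fin q → ℝ)} {c δ : ℝ} (hc : 0 ≤ c)
    (hW : (gauss (Fin n × Fin q)).real Wᶜ ≤ δ)
    (h : ∀ G ∈ W, c ≤ P.real {ω | τ < alg.run (Matrix.of (gram G)) ω r}) :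
    c * (1 - δ) ≤ (exceedProb P alg r τ q).toReal := by
  have hne : exceedProb P alg r τ q ≠ ⊤ := ((exceedProb_le_one alg r τ q).trans_lt
    ENNReal.one_lt_top).ne
  have hms : Measurable fun G : Fin n × Fin q → ℝ =>
      P {ω | τ < alg.run (Matrix.of (gram G)) ω r} :=
    (measurable_measure_prodMk_left (measurableSet_exceed alg r τ)).comp measurable_gram
  have h1 := mul_meas_ge_le_lintegral (μ := gauss (Fin n × Fin q)) hms (ENNReal.ofReal c)
  have h2 : ENNReal.ofReal c * gauss (Fin n × Fin q) W ≤ exceedProb P alg r τ q := by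
    refine le_trans ?_ h1
    gcongr
    intro G hG
    exact ENNReal.ofReal_le_of_le_toReal (h G hG)
  have h3 := ENNReal.toReal_mono hne h2
  rw [ENNReal.toReal_mul, ENNReal.toReal_ofReal hc] at h3
  have h4 : 1 ≤ (gauss (Fin n × Fin q)).real W + (gauss (Fin n × Fin q)).real Wᶜ := by
    rw [← probReal_univ (μ := gauss (Fin n × Fin q)), ← Set.union_compl_self W]
    exact measureReal_union_le _ _
  refine le_trans ?_ h3
  change c * (1 - δ) ≤ c * (gauss (Fin n × Fin q)).real W
  gcongr
  linarith

theorem exceedProb_le {q : ℕ} (alg : MatVecAlgorithm Ω n k) (r : Fin n) (τ : ℝ)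
    {W : Set (Fin n × Fin q → ℝ)} {c δ : ℝ} (hc : 0 ≤ c)
    (hW : (gauss (Fin n × Fin q)).real Wᶜ ≤ δ)
    (h : ∀ G ∈ W, P.real {ω | τ < alg.run (Matrix.of (gram G)) ω r} ≤ c) :
    (exceedProb P alg r τ q).toReal ≤ c + δ := by
  -- A measurable hull of the exceptional set, since W is not assumed measurable.
  set T := toMeasurable (gauss (Fin n × Fin q)) Wᶜ
  have hδ : 0 ≤ δ := measureReal_nonneg.trans hW
  have h1 : exceedProb P alg r τ q ≤ ENNReal.ofReal (c + δ) := by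
    calc exceedProb P alg r τ q ≤ ∫⁻ G, (ENNReal.ofReal c + T.indicator 1 G)
          ∂gauss (Fin n × Fin q) := by
          refine lintegral_mono fun G => ?_
          by_cases hG : G ∈ W
          · refine le_add_right ?_
            exact (ENNReal.le_ofReal_iff_toReal_le (measure_ne_top _ _) hc).2 (h G hG)
          · refine le_add_left ?_
            rw [Set.indicator_of_mem (subset_toMeasurable _ _ hG)]
            exact prob_le_one
      _ = ENNReal.ofReal c + gauss (Fin n × Fin q) Wᶜ := by
          rw [lintegral_add_left measurable_const,
            lintegral_indicator_one (measurableSet_toMeasurable _ _), measure_toMeasurable]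
          simp
      _ ≤ ENNReal.ofReal c + ENNReal.ofReal δ := by
          gcongr
          exact (ENNReal.le_ofReal_iff_toReal_le (measure_ne_top _ _) hδ).2 hW
      _ = _ := (ENNReal.ofReal_add hc hδ).symm
  exact ENNReal.toReal_le_of_le_ofReal (by positivity) h1

/-- An estimator with accuracy `ε` needs more than a constant multiple of `1 / ε²` queries. -/
theorem EstimatesEigenvalues.le_queries {ε : ℝ} (hε : 0 < ε) (hk : 0 < k)
    (hn : 1 / ε ^ 2 ≤ n) {alg : MatVecAlgorithm Ω n k} (h : EstimatesEigenvalues P alg ε) :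
    1 / 2 ^ 40 ≤ k * ε ^ 2 := by
  by_contra! hlt
  have hnk : 2 ^ 40 * (k : ℝ) ≤ n := by
    refine le_trans ?_ hn
    rw [le_div_iff₀ (by positivity)]
    linarith
  have hnk' : 2 ^ 40 * k ≤ n := by exact_mod_cast hnk
  obtain ⟨m, rfl⟩ : ∃ m, n = m + k := ⟨n - k, by omega⟩
  generalize hN : ((m + k : ℕ) : ℝ) = N at hn hnk
  have hk1 : (1 : ℝ) ≤ k := by exact_mod_cast hk
  have hN0 : 0 < N := by linarith
  -- Index 8k is the first eigenvalue that vanishes at rank 8k; it is written as s + k with s = 7k.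
  let r : Fin (m + k) := ⟨7 * k + k, by omega⟩
  set τ : ℝ := N / 4096 with hτ
  have hδ : (2 : ℝ) * (1 / 2) ^ (m + k) ≤ 1 / 100 := by
    calc (2 : ℝ) * (1 / 2) ^ (m + k) ≤ 2 * (1 / 2) ^ 10 := by
          gcongr 2 * ?_
          exact pow_le_pow_of_le_one (by norm_num) (by norm_num) (by omega)
      _ ≤ _ := by norm_num
  have herr : ∀ q ≤ 7 * k + k + 2, ∀ G ∈ wellConditioned (m + k) q,
      ε * frobeniusNorm (Matrix.of (gram G)) ≤ τ := fun q hq G hG => by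
    have h1 := frobeniusNorm_gram_le G fun x => (hG x).2
    rw [mul_pow, Real.sq_sqrt (Nat.cast_nonneg _), hN] at h1
    -- Here q ≤ 10k and kε² < 2⁻⁴⁰, so ε²q ≤ 2⁻³⁶. Then 64N · 2⁻¹⁸ = N/4096 = τ, a quarter of the
    -- eigenvalue bound N/1024.
    have h2 : ε * Real.sqrt q ≤ 1 / 2 ^ 18 := by
      refine abs_le_of_sq_le_sq' ?_ (by norm_num) |>.2
      rw [mul_pow, Real.sq_sqrt (Nat.cast_nonneg _)]
      have : (q : ℝ) ≤ 10 * k := by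
        have : q ≤ 10 * k := by omega
        exact_mod_cast this
      nlinarith [sq_nonneg ε]
    calc ε * frobeniusNorm (Matrix.of (gram G)) ≤ ε * (8 ^ 2 * N * Real.sqrt q) := by gcongr
      _ = 8 ^ 2 * N * (ε * Real.sqrt q) := by ring
      _ ≤ 8 ^ 2 * N * (1 / 2 ^ 18) := by gcongr
      _ ≤ τ := by rw [hτ]; linarith
  have hlow : (exceedProb P alg r τ (7 * k + k)).toReal ≤ 1 / 4 + 1 / 100 := by
    refine exceedProb_le alg r τ (by norm_num)
      ((measureReal_compl_wellConditioned_le (by omega) (by omega)).trans hδ) fun G hG => ?_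
    have hs : MeasurableSet {ω | τ < alg.run (Matrix.of (gram G)) ω r} :=
      measurable_prodMk_left (measurableSet_exceed alg r τ)
    have h1 := (h _ (posSemidef_gram G).isHermitian).trans
      (measureReal_mono (μ := P) (s₂ := {ω | τ < alg.run (Matrix.of (gram G)) ω r}ᶜ) fun ω hω => by
        have h2 := (abs_le.1 (hω r)).2
        rw [sortedEigenvalues_gram_eq_zero G (le_refl _)] at h2
        have h3 := herr _ (by omega) G hG
        simp only [Set.mem_compl_iff, Set.mem_ofPred_eq, not_lt]
        linarith)
    rw [probReal_compl_eq_one_sub hs] at h1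
    linarith
  have hhigh : 3 / 4 * (1 - 1 / 100) ≤ (exceedProb P alg r τ (7 * k + k + 2)).toReal := by
    refine le_exceedProb alg r τ (by norm_num)
      ((measureReal_compl_wellConditioned_le (by omega) (by omega)).trans hδ) fun G hG => ?_
    refine (h _ (posSemidef_gram G).isHermitian).trans
      (measureReal_mono (μ := P) fun ω hω => ?_)
    have h2 := (abs_le.1 (hω r)).1
    have h3 := herr _ le_rfl G hG
    have h4 := le_sortedEigenvalues_gram G (σ := Real.sqrt N / 32) (by positivity)
      (fun x => by rw [← hN]; exact (hG x).1) (r := r) (by simp [r])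
    rw [div_pow, Real.sq_sqrt hN0.le] at h4
    simp only [Set.mem_ofPred_eq]
    linarith
  have hmain := sq_exceedProb_le (P := P) alg r τ (7 * k)
  have hne : exceedProb P alg r τ (7 * k + k) ≠ ⊤ :=
    ((exceedProb_le_one alg r τ _).trans_lt ENNReal.one_lt_top).ne
  have h5 := ENNReal.toReal_mono (ENNReal.mul_ne_top (ENNReal.natCast_ne_top _) hne) hmain
  simp only [ENNReal.toReal_mul, ENNReal.toReal_natCast, ENNReal.toReal_pow] at h5
  push_cast at h5
  set X := (exceedProb P alg r τ (7 * k + k + 2)).toReal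
  set Y := (exceedProb P alg r τ (7 * k + k)).toReal
  -- The two success estimates give X ≥ 0.7425 and Y ≤ 0.26.
  have h6 : (0.55 : ℝ) ≤ X ^ 2 := by nlinarith
  have h7 : ((7 * k + 2) * (7 * k + 1) : ℝ) * 0.55 ≤ (7 * k + k + 2) * (7 * k + k + 1) * 0.26 := by
    calc ((7 * k + 2) * (7 * k + 1) : ℝ) * 0.55 ≤ (7 * k + 2) * (7 * k + 1) * X ^ 2 := by gcongr
      _ ≤ (7 * k + k + 2) * (7 * k + k + 1) * Y := h5
      _ ≤ _ := by gcongr; linarith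
  -- Each coefficient in k is larger on the left; the leading ones are 49 · 0.55 and 64 · 0.26.
  nlinarith

end LowerBound

theorem mainTheorem7 :
    ∃ c : ℝ, 0 < c ∧
      ∀ (ε : ℝ), 0 < ε → ε < 1 →
      ∀ (n : ℕ), 1 / ε ^ 2 ≤ (n : ℝ) →
      ∀ (Ω : Type*) [MeasurableSpace Ω] (P : Measure Ω) [IsProbabilityMeasure P]
        (k : ℕ) (alg : MatVecAlgorithm Ω n k),
        EstimatesEigenvalues P alg ε → c / ε ^ 2 ≤ (k : ℝ) := by
  refine ⟨1 / 2 ^ 40, by norm_num, fun ε hε hε1 n hn Ω _ P _ k alg h => ?_⟩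
  have hn0 : 0 < n := by
    have : (0 : ℝ) < n := lt_of_lt_of_le (by positivity) hn
    exact_mod_cast this
  rw [div_le_iff₀ (by positivity)]
  -- The case k = 0 is excluded separately: only for k ≥ 1 does failure of the bound force n to be
  -- large.
  exact h.le_queries hε (h.queries_pos hε1 hn0) hn
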